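/- **Setting.** A *nondegenerate* matrix is a square $0$-$1$ matrix, with finite index set, without zero rows and zero columns. For such $A=(a_{ij})$ let $\mathcal O_A$ be the Cuntz–Krieger algebra: the universal unital C$^*$-algebra generated by partial isometries $s_i$ (the canonical generators) with $s_i^*s_i=\sum_j a_{ij}s_js_j^*$ and $\sum_i s_is_i^*=1$. For $A_1,A_2$ nondegenerate let $A_1\boxtimes A_2$ be their Kronecker product, indexed by pairs $(i,j)$, let $\otimes$ denote the minimal tensor product of C$^*$-algebras and $\odot$ the algebraic one, and let $\varphi=\varphi_{A_1,A_2}:\mathcal O_{A_1\boxtimes A_2}\to\mathcal O_{A_1}\otimes\mathcal O_{A_2}$ be the unital $*$-homomorphism with $\varphi(s_{(i,j)})=s_i\otimes s_j$. For states $\rho_i$ on $\mathcal O_{A_i}$ put $\rho_1\otimes_\varphi\rho_2=(\rho_1\otimes\rho_2)\circ\varphi$. Let $\tau$ be a strongly continuous action of $\mathbb R$ on a unital C$^*$-algebra $X$ by $*$-automorphisms, $\rho$ a state on $X$ and $\beta\in\mathbb R$. The *KMS condition at inverse temperature $\beta$ holds on* a $*$-subalgebra $M\subset X$ if $M$ is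 norm dense and $\tau$-invariant, every $b\in M$ is entire analytic for $\tau$ (that is, $t\mapsto\tau_t(b)$ extends to an entire function $z\mapsto\tau_z(b)\in X$), and $\rho(a\,\tau_{i\beta}(b))=\rho(ba)$ for all $a,b\in M$. The state $\rho$ is a *$\tau$-KMS state at inverse temperature $\beta$* if this is so for some $M$. **Statement.** Let $A_1,A_2$ be nondegenerate, let $\alpha^{(i)}$ be a strongly continuous action of $\mathbb R$ on $\mathcal O_{A_i}$ by $*$-automorphisms, let $\rho_i$ be a state on $\mathcal O_{A_i}$, and let $\beta_i\neq0$ be real $(i=1,2)$. Put $\Theta_t=\alpha^{(1)}_{\beta_1t}\otimes\alpha^{(2)}_{\beta_2t}$ on $\mathcal O_{A_1}\otimes\mathcal O_{A_2}$. (a) Suppose that for $i=1,2$ the KMS condition for $\rho_i$ and $\alpha^{(i)}$ at inverse temperature $\beta_i$ holds on a $*$-subalgebra $\mathcal B_i$ of $\mathcal O_{A_i}$, and that there is a dense $*$-subalgebra $\mathcal C$ of $\mathcal O_{A_1\boxtimes A_2}$ such that (i) $\varphi(\mathcal C)\subset\mathcal B_1\odot\mathcal B_2$, and (ii) $\Theta_t(\varphi(\mathcal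 C))\subset\varphi(\mathcal C)$ for all $t\in\mathbb R$. Then $\varphi$ is injective, $(\alpha^{(1)}\otimes_\varphi\alpha^{(2)})_t=\varphi^{-1}\circ\Theta_t\circ\varphi$ is a well-defined strongly continuous action of $\mathbb R$ on $\mathcal O_{A_1\boxtimes A_2}$ by $*$-automorphisms, and $\rho_1\otimes_\varphi\rho_2$ is an $(\alpha^{(1)}\otimes_\varphi\alpha^{(2)})$-KMS state at inverse temperature $1$. (b) Suppose that the KMS condition for $\rho_i$ and $\alpha^{(i)}$ at inverse temperature $\beta_i$ holds on the $*$-subalgebra $\mathcal B_i$ generated by the canonical generators of $\mathcal O_{A_i}$, $i=1,2$, and let $\mathcal C$ be the $*$-subalgebra generated by the canonical generators of $\mathcal O_{A_1\boxtimes A_2}$. Then $\mathcal C$ is dense and satisfies (i). If moreover $\Theta_t(\varphi(\mathcal O_{A_1\boxtimes A_2}))\subset\varphi(\mathcal O_{A_1\boxtimes A_2})$ for all $t\in\mathbb R$, so that $\varphi^{-1}\circ\Theta_t\circ\varphi$ makes sense (this is automatic as soon as some $\mathcal C$ as in (a) exists), then $\mathcal C$ also satisfies (ii). -/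

import Mathlib

open scoped ENNReal TensorProduct InnerProductSpace Kronecker ComplexOrder

noncomputable section

namespace KMSProduct

universe u

/-! ### Bounded families of elements of C⋆-algebras -/

/-- The C⋆-algebra of all norm bounded families of elements of the C⋆-algebras `B i`. -/
abbrev BddFamily {I : Type*} (B : I → Type*) [∀ i, CStarAlgebra (B i)] := lp B ∞

instance {I : Type*} (B : I → Type*) [∀ i, CStarAlgebra (B i)]
    [∀ i, NormOneClass (B i)] : CStarAlgebra (BddFamily B) where

/-- The C⋆-subalgebra generated by a subset of a unital C⋆-algebra. -/
def cstarGen {W : Type*} [CStarAlgebra W] (S : Set W) : StarSubalgebra ℂ W :=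
  (StarAlgebra.adjoin ℂ S).topologicalClosure

instance {W : Type*} [CStarAlgebra W] (S : Set W) : IsClosed (cstarGen S : Set W) :=
  StarSubalgebra.isClosed_topologicalClosure _

theorem subset_cstarGen {W : Type*} [CStarAlgebra W] (S : Set W) : S ⊆ cstarGen S :=
  (StarAlgebra.subset_adjoin ℂ S).trans (StarSubalgebra.le_topologicalClosure _)

theorem map_mem_of_mem_cstarGen {W V : Type*} [CStarAlgebra W] [CStarAlgebra V]
    (g : W →⋆ₐ[ℂ] V) {S : Set W} {T : StarSubalgebra ℂ V} (hT : IsClosed (T : Set V))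
    (h : ∀ x ∈ S, g x ∈ T) {x : W} (hx : x ∈ cstarGen S) : g x ∈ T := by
  have hg : Continuous g := AddMonoidHomClass.continuous_of_bound g 1 fun x => by
    simpa using NonUnitalStarAlgHom.norm_apply_le g x
  have h1 : StarAlgebra.adjoin ℂ S ≤ T.comap g := StarAlgebra.adjoin_le h
  have h2 : IsClosed ((T.comap g : StarSubalgebra ℂ W) : Set W) := hT.preimage hg
  exact StarSubalgebra.topologicalClosure_minimal h1 h2 hx

/-! ### Completed tensor products of Hilbert spaces -/

section Hilbert

variable (H K : Type*) [NormedAddCommGroup H] [InnerProductSpace ℂ H]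
  [NormedAddCommGroup K] [InnerProductSpace ℂ K]

/-- The Hilbert space tensor product: the completion of the algebraic tensor product. -/
def HTensor := UniformSpace.Completion (H ⊗[ℂ] K)

instance : NormedAddCommGroup (HTensor H K) :=
  inferInstanceAs (NormedAddCommGroup (UniformSpace.Completion (H ⊗[ℂ] K)))

instance : InnerProductSpace ℂ (HTensor H K) :=
  inferInstanceAs (InnerProductSpace ℂ (UniformSpace.Completion (H ⊗[ℂ] K)))

instance : CompleteSpace (HTensor H K) :=
  inferInstanceAs (CompleteSpace (UniformSpace.Completion (H ⊗[ℂ] K)))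

/-- The isometric inclusion of the algebraic tensor product. -/
def HTensor.of : H ⊗[ℂ] K →ₗᵢ[ℂ] HTensor H K :=
  UniformSpace.Completion.toComplₗᵢ

instance [Nontrivial H] [Nontrivial K] : Nontrivial (HTensor H K) :=
  (HTensor.of H K).injective.nontrivial

variable {H K}

theorem HTensor.denseRange_of : DenseRange (HTensor.of H K) :=
  UniformSpace.Completion.denseRange_coe (α := H ⊗[ℂ] K)

/-- The bounded operator `S ⊗ T` on the Hilbert space tensor product. -/
def opTensor (S : H →L[ℂ] H) (T : K →L[ℂ] K) : HTensor H K →L[ℂ] HTensor H K :=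
  (TensorProduct.mapL S T).completion

theorem opTensor_of (S : H →L[ℂ] H) (T : K →L[ℂ] K) (x : H ⊗[ℂ] K) :
    opTensor S T (HTensor.of H K x) = HTensor.of H K (TensorProduct.mapL S T x) :=
  ContinuousLinearMap.completion_apply_coe (TensorProduct.mapL S T) x

theorem op_ext {S T : HTensor H K →L[ℂ] HTensor H K}
    (h : ∀ x : H ⊗[ℂ] K, S (HTensor.of H K x) = T (HTensor.of H K x)) : S = T :=
  ContinuousLinearMap.coeFn_injective
    (HTensor.denseRange_of.equalizer S.continuous T.continuous (funext h))

theorem opTensor_mul (S S' : H →L[ℂ] H) (T T' : K →L[ℂ] K) :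
    opTensor (S * S') (T * T') = opTensor S T * opTensor S' T' := by
  refine op_ext fun x => ?_
  rw [mul_apply_eq_comp, opTensor_of, opTensor_of, opTensor_of,
    TensorProduct.mapL_mul]
  rfl

theorem opTensor_one : opTensor (1 : H →L[ℂ] H) (1 : K →L[ℂ] K) = 1 := by
  refine op_ext fun x => ?_
  rw [opTensor_of]
  have : TensorProduct.mapL (1 : H →L[ℂ] H) (1 : K →L[ℂ] K) = .id ℂ _ :=
    TensorProduct.mapL_id_id
  rw [this]; rfl

theorem opTensor_add_left (S S' : H →L[ℂ] H) (T : K →L[ℂ] K) :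
    opTensor (S + S') T = opTensor S T + opTensor S' T := by
  refine op_ext fun x => ?_
  rw [add_apply, opTensor_of, opTensor_of, opTensor_of,
    TensorProduct.mapL_add_left, add_apply, map_add]

theorem opTensor_add_right (S : H →L[ℂ] H) (T T' : K →L[ℂ] K) :
    opTensor S (T + T') = opTensor S T + opTensor S T' := by
  refine op_ext fun x => ?_
  rw [add_apply, opTensor_of, opTensor_of, opTensor_of,
    TensorProduct.mapL_add_right, add_apply, map_add]

theorem opTensor_smul_left (c : ℂ) (S : H →L[ℂ] H) (T : K →L[ℂ] K) :
    opTensor (c • S) T = c • opTensor S T := by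
  refine op_ext fun x => ?_
  rw [smul_apply, opTensor_of, opTensor_of, TensorProduct.mapL_smul_left, smul_apply,
    map_smul]

theorem opTensor_smul_right (c : ℂ) (S : H →L[ℂ] H) (T : K →L[ℂ] K) :
    opTensor S (c • T) = c • opTensor S T := by
  refine op_ext fun x => ?_
  rw [smul_apply, opTensor_of, opTensor_of, TensorProduct.mapL_smul_right, smul_apply,
    map_smul]

variable (H K) in
/-- The bilinear map `(S, T) ↦ S ⊗ T`. -/
def opTensorₗ : (H →L[ℂ] H) →ₗ[ℂ] (K →L[ℂ] K) →ₗ[ℂ] (HTensor H K →L[ℂ] HTensor H K) :=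
  LinearMap.mk₂ ℂ opTensor opTensor_add_left opTensor_smul_left opTensor_add_right
    opTensor_smul_right

theorem opTensor_sum_left {α : Type*} (s : Finset α) (S : α → H →L[ℂ] H) (T : K →L[ℂ] K) :
    opTensor (∑ i ∈ s, S i) T = ∑ i ∈ s, opTensor (S i) T :=
  LinearMap.map_sum₂ (opTensorₗ H K) s S T

theorem opTensor_sum_right {α : Type*} (s : Finset α) (S : H →L[ℂ] H) (T : α → K →L[ℂ] K) :
    opTensor S (∑ i ∈ s, T i) = ∑ i ∈ s, opTensor S (T i) :=
  map_sum (opTensorₗ H K S) T s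

theorem opTensor_nsmul (m n : ℕ) (S : H →L[ℂ] H) (T : K →L[ℂ] K) :
    opTensor (m • S) (n • T) = (m * n) • opTensor S T := by
  rw [← Nat.cast_smul_eq_nsmul ℂ, ← Nat.cast_smul_eq_nsmul ℂ, ← Nat.cast_smul_eq_nsmul ℂ,
    opTensor_smul_left, opTensor_smul_right, smul_smul, Nat.cast_mul]

theorem opTensor_star [CompleteSpace H] [CompleteSpace K] (S : H →L[ℂ] H) (T : K →L[ℂ] K) :
    opTensor (star S) (star T) = star (opTensor S T) := by
  refine (ContinuousLinearMap.eq_adjoint_iff _ _).2 fun x y => ?_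
  refine HTensor.denseRange_of.induction_on₂ (p := fun x y =>
    ⟪opTensor (star S) (star T) x, y⟫_ℂ = ⟪x, opTensor S T y⟫_ℂ) ?_ (fun x y => ?_) x y
  · apply isClosed_eq <;> fun_prop
  · rw [opTensor_of, opTensor_of, LinearIsometry.inner_map_map, LinearIsometry.inner_map_map]
    induction x with
    | zero => simp
    | add x x' hx hx' => rw [map_add, inner_add_left, inner_add_left, hx, hx']
    | tmul a b =>
      induction y with
      | zero => simp
      | add y y' hy hy' => rw [map_add, inner_add_right, inner_add_right, hy, hy']
      | tmul c d =>
        rw [TensorProduct.mapL_tmul, TensorProduct.mapL_tmul, TensorProduct.inner_tmul,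
          TensorProduct.inner_tmul, ContinuousLinearMap.star_eq_adjoint,
          ContinuousLinearMap.star_eq_adjoint, ContinuousLinearMap.adjoint_inner_left,
          ContinuousLinearMap.adjoint_inner_left]

theorem norm_opTensor_le (S : H →L[ℂ] H) (T : K →L[ℂ] K) : ‖opTensor S T‖ ≤ ‖S‖ * ‖T‖ := by
  refine ContinuousLinearMap.opNorm_le_bound _ (by positivity) fun x => ?_
  refine HTensor.denseRange_of.induction_on (p := fun x =>
    ‖opTensor S T x‖ ≤ ‖S‖ * ‖T‖ * ‖x‖) x ?_ fun x => ?_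
  · apply isClosed_le <;> fun_prop
  · rw [opTensor_of, LinearIsometry.norm_map, LinearIsometry.norm_map]
    exact (ContinuousLinearMap.le_opNorm _ _).trans
      (mul_le_mul_of_nonneg_right (TensorProduct.norm_mapL_le S T) (norm_nonneg _))

end Hilbert

/-! ### The minimal tensor product of C⋆-algebras -/

/-- A unital ⋆-representation on a nonzero Hilbert space. -/
structure HRep (X : Type u) [CStarAlgebra X] : Type (u + 1) where
  H : Type u
  [instNorm : NormedAddCommGroup H]
  [instInner : InnerProductSpace ℂ H]
  [instComplete : CompleteSpace H]
  [instNontrivial : Nontrivial H]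
  π : X →⋆ₐ[ℂ] (H →L[ℂ] H)

attribute [instance] HRep.instNorm HRep.instInner HRep.instComplete HRep.instNontrivial

/-- Pull-back of a representation along a unital ⋆-homomorphism. -/
abbrev HRep.comp {X X' : Type u} [CStarAlgebra X] [CStarAlgebra X'] (r : HRep X')
    (f : X →⋆ₐ[ℂ] X') : HRep X where
  H := r.H
  π := r.π.comp f

section MinTensor

variable (X Y : Type u) [CStarAlgebra X] [CStarAlgebra Y]

/-- The bounded families of operators on the spaces `H₁ ⊗ H₂`, indexed by all pairs of
representations of `X` on `H₁` and of `Y` on `H₂`. -/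
abbrev TensorAmbient : Type (u + 1) :=
  BddFamily fun p : HRep X × HRep Y => HTensor p.1.H p.2.H →L[ℂ] HTensor p.1.H p.2.H

variable {X Y}

/-- The family `(π₁(a) ⊗ π₂(b))` indexed by the pairs of representations `(π₁, π₂)`. -/
def tmulFamily (a : X) (b : Y) : TensorAmbient X Y :=
  ⟨fun p => opTensor (p.1.π a) (p.2.π b), memℓp_infty_iff.2 ⟨‖a‖ * ‖b‖, by
    rintro _ ⟨p, rfl⟩
    refine (norm_opTensor_le _ _).trans ?_
    gcongr
    · exact NonUnitalStarAlgHom.norm_apply_le p.1.π a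
    · exact NonUnitalStarAlgHom.norm_apply_le p.2.π b⟩⟩

variable (X Y)

/-- The set of all elementary tensors. -/
def elemTensors : Set (TensorAmbient X Y) := {z | ∃ a b, z = tmulFamily a b}

/-- The minimal (spatial) tensor product: the completion of the algebraic tensor product for the
norm `‖x‖ = sup ‖(π₁ ⊗ π₂)(x)‖` over all pairs of representations, realised as the C⋆-algebra
generated by the elementary tensors. -/
def MinTensor : Type (u + 1) :=
  cstarGen (elemTensors X Y)

instance : CStarAlgebra (MinTensor X Y) :=
  inferInstanceAs (CStarAlgebra (cstarGen (elemTensors X Y)))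

/-- The inclusion into the algebra of bounded families. -/
def MinTensor.incl : MinTensor X Y →⋆ₐ[ℂ] TensorAmbient X Y :=
  (cstarGen (elemTensors X Y)).subtype

variable {X Y}

/-- The elementary tensor `a ⊗ b`. -/
def tmul (a : X) (b : Y) : MinTensor X Y :=
  ⟨tmulFamily a b, subset_cstarGen _ ⟨a, b, rfl⟩⟩

variable {X' Y' : Type u} [CStarAlgebra X'] [CStarAlgebra Y']

/-- The map of bounded families induced by `(π₁, π₂) ↦ (π₁ ∘ f, π₂ ∘ g)`. -/
def pullback (f : X →⋆ₐ[ℂ] X') (g : Y →⋆ₐ[ℂ] Y') :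
    TensorAmbient X Y →⋆ₐ[ℂ] TensorAmbient X' Y' where
  toFun x := ⟨fun p => x (p.1.comp f, p.2.comp g), memℓp_infty_iff.2 <| by
    obtain ⟨C, hC⟩ := (lp.memℓp x).bddAbove
    exact ⟨C, by rintro _ ⟨j, rfl⟩; exact hC ⟨(j.1.comp f, j.2.comp g), rfl⟩⟩⟩
  map_one' := rfl
  map_mul' _ _ := rfl
  map_zero' := rfl
  map_add' _ _ := rfl
  commutes' _ := rfl
  map_star' _ := rfl

/-- The ⋆-homomorphism `f ⊗ g` of minimal tensor products. -/
def MinTensor.map (f : X →⋆ₐ[ℂ] X') (g : Y →⋆ₐ[ℂ] Y') : MinTensor X Y →⋆ₐ[ℂ] MinTensor X' Y' :=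
  StarAlgHom.codRestrict ((pullback f g).comp (MinTensor.incl X Y))
    (cstarGen (elemTensors X' Y')) fun x =>
      map_mem_of_mem_cstarGen (W := TensorAmbient X Y) (V := TensorAmbient X' Y') (pullback f g)
        (T := cstarGen (elemTensors X' Y')) inferInstance
        (by rintro _ ⟨a, b, rfl⟩; exact subset_cstarGen _ ⟨f a, g b, rfl⟩) x.2

theorem MinTensor.map_tmul (f : X →⋆ₐ[ℂ] X') (g : Y →⋆ₐ[ℂ] Y') (a : X) (b : Y) :
    MinTensor.map f g (tmul a b) = tmul (f a) (g b) := rfl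

/-- The algebraic tensor product `M ⊙ N` inside the minimal tensor product. -/
def algTensor (M : NonUnitalStarSubalgebra ℂ X) (N : NonUnitalStarSubalgebra ℂ Y) :
    Submodule ℂ (MinTensor X Y) :=
  Submodule.span ℂ {z | ∃ a ∈ M, ∃ b ∈ N, z = tmul a b}

end MinTensor

/-! ### States -/

/-- A state of a unital C⋆-algebra. -/
structure CState (X : Type*) [CStarAlgebra X] extends X →ₗ[ℂ] ℂ where
  nonneg' : ∀ a, 0 ≤ toFun (star a * a)
  map_one' : toFun 1 = 1

instance {X : Type*} [CStarAlgebra X] : CoeFun (CState X) fun _ => X → ℂ :=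
  ⟨fun ρ => ρ.toLinearMap⟩

/-- The restriction of a state along a unital ⋆-homomorphism. -/
def CState.comp {X Y : Type*} [CStarAlgebra X] [CStarAlgebra Y] (ρ : CState Y)
    (f : X →⋆ₐ[ℂ] Y) : CState X where
  toLinearMap := ρ.toLinearMap ∘ₗ (f : X →ₐ[ℂ] Y).toLinearMap
  nonneg' a := by
    have := ρ.nonneg' (f a)
    rw [← map_star, ← map_mul] at this
    exact this
  map_one' := by
    have := ρ.map_one'
    rw [← map_one f] at this
    exact this

section GNS

variable {X Y : Type u} [CStarAlgebra X] [CStarAlgebra Y]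

attribute [local instance] CStarAlgebra.spectralOrder CStarAlgebra.spectralOrderedRing

/-- A state as a positive linear map. -/
def CState.toPositive (ρ : CState X) : X →ₚ[ℂ] ℂ :=
  PositiveLinearMap.mk₀ ρ.toLinearMap fun x hx => by
    obtain ⟨b, rfl⟩ := CStarAlgebra.nonneg_iff_eq_star_mul_self.1 hx
    exact ρ.nonneg' b

theorem CState.inner_toPreGNS_one (ρ : CState X) (a : X) :
    ⟪((ρ.toPositive.toPreGNS 1 : ρ.toPositive.PreGNS) : ρ.toPositive.GNS),
      ρ.toPositive.gnsStarAlgHom a (ρ.toPositive.toPreGNS 1 : ρ.toPositive.PreGNS)⟫_ℂ = ρ a := by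
  have h : ρ.toPositive.gnsStarAlgHom a (ρ.toPositive.toPreGNS 1 : ρ.toPositive.PreGNS) =
      ((ρ.toPositive.leftMulMapPreGNS a (ρ.toPositive.toPreGNS 1) : ρ.toPositive.PreGNS) :
        ρ.toPositive.GNS) := PositiveLinearMap.gnsNonUnitalStarAlgHom_apply_coe ρ.toPositive
  rw [h, UniformSpace.Completion.inner_coe, PositiveLinearMap.preGNS_inner_def]
  simp
  rfl

theorem CState.nontrivial_gns (ρ : CState X) : Nontrivial ρ.toPositive.GNS := by
  refine ⟨⟨((ρ.toPositive.toPreGNS 1 : ρ.toPositive.PreGNS) : ρ.toPositive.GNS), 0, fun h => ?_⟩⟩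
  have h1 := ρ.inner_toPreGNS_one 1
  rw [h, inner_zero_left] at h1
  exact zero_ne_one (h1.trans ρ.map_one')

/-- The GNS representation of a state. -/
def CState.gns (ρ : CState X) : HRep X :=
  haveI := ρ.nontrivial_gns
  { H := ρ.toPositive.GNS
    π := ρ.toPositive.gnsStarAlgHom }

/-- The cyclic vector of the GNS representation of a state. -/
def CState.gnsVector (ρ : CState X) : ρ.gns.H :=
  ((ρ.toPositive.toPreGNS 1 : ρ.toPositive.PreGNS) : ρ.toPositive.GNS)

theorem CState.inner_gnsVector (ρ : CState X) (a : X) :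
    ⟪ρ.gnsVector, ρ.gns.π a ρ.gnsVector⟫_ℂ = ρ a :=
  ρ.inner_toPreGNS_one a

/-- The vector `Ω₁ ⊗ Ω₂` in the tensor product of the GNS spaces of two states. -/
def CState.gnsPairVector (ρ₁ : CState X) (ρ₂ : CState Y) : HTensor ρ₁.gns.H ρ₂.gns.H :=
  HTensor.of ρ₁.gns.H ρ₂.gns.H (ρ₁.gnsVector ⊗ₜ[ℂ] ρ₂.gnsVector)

/-- The product state `ρ₁ ⊗ ρ₂` of the minimal tensor product: the vector state of
`Ω₁ ⊗ Ω₂` in the tensor product of the GNS representations. -/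
def CState.tensor (ρ₁ : CState X) (ρ₂ : CState Y) : CState (MinTensor X Y) where
  toFun x := ⟪ρ₁.gnsPairVector ρ₂, MinTensor.incl X Y x (ρ₁.gns, ρ₂.gns) (ρ₁.gnsPairVector ρ₂)⟫_ℂ
  map_add' x y := by
    rw [map_add, lp.coeFn_add, Pi.add_apply, add_apply, inner_add_right]
  map_smul' c x := by
    rw [map_smul, lp.coeFn_smul, Pi.smul_apply, smul_apply, inner_smul_right]
    rfl
  nonneg' a := by
    rw [map_mul, map_star]
    have h : ∀ T : HTensor ρ₁.gns.H ρ₂.gns.H →L[ℂ] HTensor ρ₁.gns.H ρ₂.gns.H,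
        0 ≤ ⟪ρ₁.gnsPairVector ρ₂, (star T * T) (ρ₁.gnsPairVector ρ₂)⟫_ℂ := fun T => by
      rw [mul_apply_eq_comp, ContinuousLinearMap.star_eq_adjoint,
        ContinuousLinearMap.adjoint_inner_right]
      rw [inner_self_eq_norm_sq_to_K]
      rw [← RCLike.ofReal_pow]
      exact Complex.zero_le_real.2 (sq_nonneg ‖T (ρ₁.gnsPairVector ρ₂)‖)
    exact h _
  map_one' := by
    rw [map_one]
    have h : ⟪ρ₁.gnsPairVector ρ₂, ρ₁.gnsPairVector ρ₂⟫_ℂ = 1 := by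
      have h1 : ⟪ρ₁.gnsVector, ρ₁.gnsVector⟫_ℂ = 1 := by
        simpa using (ρ₁.inner_gnsVector 1).trans ρ₁.map_one'
      have h2 : ⟪ρ₂.gnsVector, ρ₂.gnsVector⟫_ℂ = 1 := by
        simpa using (ρ₂.inner_gnsVector 1).trans ρ₂.map_one'
      rw [CState.gnsPairVector, LinearIsometry.inner_map_map, TensorProduct.inner_tmul]
      exact (congrArg₂ (· * ·) h1 h2).trans (mul_one 1)
    exact h

theorem CState.tensor_tmul (ρ₁ : CState X) (ρ₂ : CState Y) (a : X) (b : Y) :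
    ρ₁.tensor ρ₂ (tmul a b) = ρ₁ a * ρ₂ b := by
  show ⟪ρ₁.gnsPairVector ρ₂,
    opTensor (ρ₁.gns.π a) (ρ₂.gns.π b) (ρ₁.gnsPairVector ρ₂)⟫_ℂ = ρ₁ a * ρ₂ b
  rw [CState.gnsPairVector, opTensor_of, LinearIsometry.inner_map_map, TensorProduct.mapL_tmul,
    TensorProduct.inner_tmul]
  exact congrArg₂ (· * ·) (ρ₁.inner_gnsVector a) (ρ₂.inner_gnsVector b)

end GNS

/-! ### Cuntz–Krieger algebras -/

section CK

theorem norm_le_of_partialIsometry {D : Type*} [CStarAlgebra D] {t : D}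
    (h : t * star t * t = t) : ‖t‖ ≤ 1 := by
  have h1 : star (star t * t) * (star t * t) = star t * t := by
    rw [star_mul, star_star, mul_assoc, ← mul_assoc t, h]
  have h2 := CStarRing.norm_star_mul_self (x := star t * t)
  rw [h1, CStarRing.norm_star_mul_self] at h2
  by_contra hc
  have h3 : 1 < ‖t‖ * ‖t‖ := by nlinarith
  nlinarith

theorem small_cstarGen {W : Type*} [CStarAlgebra W] {ι : Type} (f : ι → W) :
    Small.{0} (cstarGen (Set.range f)) := by
  let g : ι ⊕ ι → W := Sum.elim f (fun i => star (f i))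
  have hadj : ((StarAlgebra.adjoin ℂ (Set.range f) : StarSubalgebra ℂ W) : Set W)
      ⊆ Set.range (FreeAlgebra.lift ℂ g) := by
    intro x hx
    have hx' : x ∈ Algebra.adjoin ℂ (Set.range g) := by
      have : Set.range g = Set.range f ∪ star (Set.range f) := by
        rw [Set.Sum.elim_range]
        congr 1
        ext y
        simp only [Set.mem_range, Set.mem_star]
        exact exists_congr fun i => ⟨fun h => by rw [← h, star_star], fun h => by rw [h, star_star]⟩
      rw [this]; exact hx
    rw [Algebra.adjoin_range_eq_range_freeAlgebra_lift] at hx'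
    exact hx'
  have hsub : ((cstarGen (Set.range f) : StarSubalgebra ℂ W) : Set W) ⊆ (Set.range fun u : ℕ → FreeAlgebra ℂ (ι ⊕ ι) =>
    Classical.epsilon fun x => Filter.Tendsto (fun n => FreeAlgebra.lift ℂ g (u n))
      Filter.atTop (nhds x)) := by
   intro x hx
   obtain ⟨u, hu, hux⟩ := mem_closure_iff_seq_limit.1 hx
   choose v hv using fun n => hadj (hu n)
   refine ⟨v, ?_⟩
   simp only [hv]
   have hex : ∃ y, Filter.Tendsto u Filter.atTop (nhds y) := ⟨x, hux⟩
   exact tendsto_nhds_unique (Classical.epsilon_spec hex) hux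
  exact small_subset hsub

/-- Transport of a C⋆-algebra structure along a bijection. -/
abbrev transferCStar {X : Type} {W : Type*} [CStarAlgebra W] (e : X ≃ W) : CStarAlgebra X :=
  letI := e.ring
  letI := e.algebra ℂ
  letI : NormedRing X := NormedRing.induced X W e.ringEquiv e.injective
  letI : NormedAlgebra ℂ X := NormedAlgebra.induced ℂ X W (e.algEquiv ℂ)
  letI : StarRing X :=
    { star := fun x => e.symm (star (e x))
      star_involutive := fun x => by simp
      star_mul := fun x y => by
        show e.symm (star (e (e.symm (e x * e y)))) =
          e.symm (e (e.symm (star (e y))) * e (e.symm (star (e x))))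
        simp
      star_add := fun x y => by
        show e.symm (star (e (e.symm (e x + e y)))) =
          e.symm (e (e.symm (star (e x))) + e (e.symm (star (e y))))
        simp }
  { norm_mul_self_le := fun x => by
      show ‖e x‖ * ‖e x‖ ≤ ‖e (e.symm (e (e.symm (star (e x))) * e x))‖
      simp [CStarRing.norm_star_mul_self]
    star_smul := fun c x => by
      show e.symm (star (e (e.symm (c • e x)))) = e.symm (star c • e (e.symm (star (e x))))
      simp
    complete := by
      have hi : Isometry e := AddMonoidHomClass.isometry_of_norm e.ringEquiv fun _ => rfl
      have : CompleteSpace X :=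
        (completeSpace_congr (e := e) hi.isUniformEmbedding).2 inferInstance
      intro f hf
      exact this.complete hf }

variable {ι : Type} [Fintype ι]

/-- A matrix with entries in `{0, 1}` that has no zero row and no zero column. -/
structure IsNondegenerate (A : Matrix ι ι ℕ) : Prop where
  entries : ∀ i j, A i j = 0 ∨ A i j = 1
  row : ∀ i, ∃ j, A i j ≠ 0
  col : ∀ j, ∃ i, A i j ≠ 0

/-- The Cuntz–Krieger relations of a matrix `A`. -/
structure IsCKFamily {D : Type*} [CStarAlgebra D] (A : Matrix ι ι ℕ) (t : ι → D) : Prop where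
  partialIsometry : ∀ i, t i * star (t i) * t i = t i
  source : ∀ i, star (t i) * t i = ∑ j, A i j • (t j * star (t j))
  sum_range : ∑ i, t i * star (t i) = 1

/-- A Cuntz–Krieger family of operators on a nonzero Hilbert space. -/
structure CKRep (A : Matrix ι ι ℕ) : Type 1 where
  H : Type
  [instNorm : NormedAddCommGroup H]
  [instInner : InnerProductSpace ℂ H]
  [instComplete : CompleteSpace H]
  [instNontrivial : Nontrivial H]
  t : ι → H →L[ℂ] H
  isCK : IsCKFamily A t

attribute [instance] CKRep.instNorm CKRep.instInner CKRep.instComplete CKRep.instNontrivial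

variable (A : Matrix ι ι ℕ)

/-- The bounded families of operators indexed by all Cuntz–Krieger families. -/
abbrev CKAmbient : Type 1 := BddFamily fun r : CKRep A => r.H →L[ℂ] r.H

/-- The universal Cuntz–Krieger family. -/
def univFamily (i : ι) : CKAmbient A :=
  ⟨fun r => r.t i, memℓp_infty_iff.2 ⟨1, by rintro _ ⟨r, rfl⟩; exact norm_le_of_partialIsometry (r.isCK.partialIsometry i)⟩⟩

/-- The C⋆-algebra generated by the universal Cuntz–Krieger family. -/
abbrev CKUniv : StarSubalgebra ℂ (CKAmbient A) := cstarGen (Set.range (univFamily A))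

instance : Small.{0} (CKUniv A) := small_cstarGen _

/-- The Cuntz–Krieger algebra `𝒪_A`: the universal C⋆-algebra generated by a Cuntz–Krieger family
of the matrix `A`, moved to the lowest universe. -/
def CKAlg : Type := Shrink.{0} (CKUniv A)

instance : CStarAlgebra (CKAlg A) := transferCStar (equivShrink (CKUniv A)).symm

/-- The identification of `𝒪_A` with the algebra generated by the universal family. -/
def CKAlg.equiv : CKAlg A ≃⋆ₐ[ℂ] CKUniv A where
  toEquiv := (equivShrink (CKUniv A)).symm
  map_mul' _ _ := (equivShrink (CKUniv A)).symm_apply_apply _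
  map_add' _ _ := (equivShrink (CKUniv A)).symm_apply_apply _
  map_star' _ := (equivShrink (CKUniv A)).symm_apply_apply _
  map_smul' _ _ := (equivShrink (CKUniv A)).symm_apply_apply _

theorem CKAlg.norm_equiv (x : CKAlg A) : ‖CKAlg.equiv A x‖ = ‖x‖ := rfl

/-- The canonical generators of `𝒪_A`. -/
def ckGen (i : ι) : CKAlg A :=
  (CKAlg.equiv A).symm ⟨univFamily A i, subset_cstarGen _ ⟨i, rfl⟩⟩

variable {A} in
theorem IsCKFamily.map {D E : Type*} [CStarAlgebra D] [CStarAlgebra E] {t : ι → D} (h : IsCKFamily A t) (f : D →⋆ₐ[ℂ] E) :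
    IsCKFamily A fun i => f (t i) where
  partialIsometry i := by rw [← map_star, ← map_mul, ← map_mul, h.partialIsometry]
  source i := by simp_rw [← map_star, ← map_mul, h.source, map_sum, map_nsmul]
  sum_range := by simp_rw [← map_star, ← map_mul, ← map_sum, h.sum_range, map_one]

variable {A} in
theorem IsCKFamily.of_map {D E : Type*} [CStarAlgebra D] [CStarAlgebra E] {t : ι → D}
    (f : D →⋆ₐ[ℂ] E) (hf : Function.Injective f) (h : IsCKFamily A fun i => f (t i)) :
    IsCKFamily A t where
  partialIsometry i := hf (by rw [map_mul, map_mul, map_star, h.partialIsometry])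
  source i := hf (by rw [map_mul, map_star, h.source]; simp_rw [map_sum, map_nsmul, map_mul, map_star])
  sum_range := hf (by simp_rw [map_sum, map_mul, map_star, map_one]; exact h.sum_range)

/-- The evaluation of bounded families at a Cuntz–Krieger family. -/
def CKAmbient.eval (r : CKRep A) : CKAmbient A →⋆ₐ[ℂ] (r.H →L[ℂ] r.H) where
  toFun x := x r
  map_one' := rfl
  map_mul' _ _ := rfl
  map_zero' := rfl
  map_add' _ _ := rfl
  commutes' _ := rfl
  map_star' _ := rfl

theorem CKAmbient.ext {x y : CKAmbient A}
    (h : ∀ r, CKAmbient.eval A r x = CKAmbient.eval A r y) : x = y :=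
  lp.ext (funext h)

theorem isCKFamily_univFamily : IsCKFamily A (univFamily A) where
  partialIsometry i := CKAmbient.ext A fun r => r.isCK.partialIsometry i
  source i := CKAmbient.ext A fun r => by
    simp_rw [map_sum, map_nsmul, map_mul, map_star]
    exact r.isCK.source i
  sum_range := CKAmbient.ext A fun r => by
    simp_rw [map_sum, map_mul, map_star, map_one]
    exact r.isCK.sum_range

/-- The inclusion of `𝒪_A` into the algebra of bounded families. -/
def CKAlg.incl : CKAlg A →⋆ₐ[ℂ] CKAmbient A :=
  (CKUniv A).subtype.comp (CKAlg.equiv A : CKAlg A →⋆ₐ[ℂ] CKUniv A)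

theorem CKAlg.incl_ckGen (i : ι) : CKAlg.incl A (ckGen A i) = univFamily A i :=
  congrArg Subtype.val ((CKAlg.equiv A).apply_symm_apply _)

theorem isCKFamily_ckGen : IsCKFamily A (ckGen A) :=
  IsCKFamily.of_map (CKAlg.incl A) (Subtype.val_injective.comp (CKAlg.equiv A).injective) (by
    simp_rw [CKAlg.incl_ckGen]
    exact isCKFamily_univFamily A)

/-- The ⋆-subalgebra generated by the canonical generators. -/
def canonicalSubalgebra : NonUnitalStarSubalgebra ℂ (CKAlg A) :=
  NonUnitalStarAlgebra.adjoin ℂ (Set.range (ckGen A))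

variable {A}

variable {κ : Type} [Fintype κ] {B : Matrix κ κ ℕ}

theorem IsCKFamily.opTensor {H K : Type*} [NormedAddCommGroup H] [InnerProductSpace ℂ H]
    [NormedAddCommGroup K] [InnerProductSpace ℂ K] [CompleteSpace H] [CompleteSpace K]
    {s : ι → H →L[ℂ] H} {t : κ → K →L[ℂ] K} (hs : IsCKFamily A s) (ht : IsCKFamily B t) :
    IsCKFamily (A ⊗ₖ B) fun p : ι × κ => opTensor (s p.1) (t p.2) where
  partialIsometry p := by
    rw [← opTensor_star, ← opTensor_mul, ← opTensor_mul, hs.partialIsometry, ht.partialIsometry]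
  source p := by
    simp_rw [← opTensor_star, ← opTensor_mul]
    rw [hs.source, ht.source, Fintype.sum_prod_type, opTensor_sum_left]
    refine Finset.sum_congr rfl fun i _ => ?_
    rw [opTensor_sum_right]
    refine Finset.sum_congr rfl fun j _ => ?_
    rw [opTensor_nsmul, Matrix.kroneckerMap_apply]
  sum_range := by
    simp_rw [← opTensor_star, ← opTensor_mul]
    rw [Fintype.sum_prod_type, ← opTensor_one, ← hs.sum_range, ← ht.sum_range, opTensor_sum_left]
    refine Finset.sum_congr rfl fun i _ => ?_
    rw [opTensor_sum_right]

variable (A B)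

theorem kronecker_isCK (r : HRep (CKAlg A)) (r' : HRep (CKAlg B)) : IsCKFamily (A ⊗ₖ B)
    fun q : ι × κ => opTensor (r.π (ckGen A q.1)) (r'.π (ckGen B q.2)) := by
  have h1 := (isCKFamily_ckGen A).map r.π
  have h2 := (isCKFamily_ckGen B).map r'.π
  exact IsCKFamily.opTensor (s := fun i => r.π (ckGen A i)) (t := fun i => r'.π (ckGen B i)) h1 h2

/-- The Cuntz–Krieger family `π₁(s_i) ⊗ π₂(s_j)` of the Kronecker product `A ⊠ B`. -/
abbrev kroneckerRep (p : HRep (CKAlg A) × HRep (CKAlg B)) : CKRep (A ⊗ₖ B) where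
  H := HTensor p.1.H p.2.H
  t := fun q => opTensor (p.1.π (ckGen A q.1)) (p.2.π (ckGen B q.2))
  isCK := kronecker_isCK A B p.1 p.2

/-- The map of bounded families induced by `(π₁, π₂) ↦ (π₁(s_i) ⊗ π₂(s_j))`. -/
def kroneckerPullback : CKAmbient (A ⊗ₖ B) →⋆ₐ[ℂ] TensorAmbient (CKAlg A) (CKAlg B) where
  toFun x := ⟨fun p => x (kroneckerRep A B p), memℓp_infty_iff.2 <| by
    obtain ⟨C, hC⟩ := (lp.memℓp x).bddAbove
    exact ⟨C, by rintro _ ⟨p, rfl⟩; exact hC ⟨kroneckerRep A B p, rfl⟩⟩⟩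
  map_one' := rfl
  map_mul' _ _ := rfl
  map_zero' := rfl
  map_add' _ _ := rfl
  commutes' _ := rfl
  map_star' _ := rfl

/-- The unital ⋆-homomorphism `φ_{A,B} : 𝒪_{A ⊠ B} → 𝒪_A ⊗ 𝒪_B` with
`φ_{A,B}(s_{(i,j)}) = s_i ⊗ s_j`. -/
def ckPhi : CKAlg (A ⊗ₖ B) →⋆ₐ[ℂ] MinTensor (CKAlg A) (CKAlg B) :=
  StarAlgHom.codRestrict
    ((kroneckerPullback A B).comp (CKAlg.incl (A ⊗ₖ B)))
    (cstarGen (elemTensors (CKAlg A) (CKAlg B))) fun x =>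
      map_mem_of_mem_cstarGen (W := CKAmbient (A ⊗ₖ B)) (V := TensorAmbient (CKAlg A) (CKAlg B))
        (kroneckerPullback A B) (T := cstarGen (elemTensors (CKAlg A) (CKAlg B))) inferInstance
        (by
          rintro _ ⟨q, rfl⟩
          exact subset_cstarGen _ ⟨ckGen A q.1, ckGen B q.2, rfl⟩)
        (CKAlg.equiv (A ⊗ₖ B) x).2

theorem ckPhi_ckGen (q : ι × κ) :
    ckPhi A B (ckGen (A ⊗ₖ B) q) = tmul (ckGen A q.1) (ckGen B q.2) := by
  refine Subtype.ext ?_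
  show kroneckerPullback A B (CKAlg.incl (A ⊗ₖ B) (ckGen (A ⊗ₖ B) q)) = _
  rw [CKAlg.incl_ckGen]
  rfl

end CK

/-! ### C⋆-dynamical systems and KMS states -/

/-- A strongly continuous one-parameter group of ⋆-automorphisms of a C⋆-algebra. -/
structure CStarFlow (X : Type*) [CStarAlgebra X] where
  toFun : ℝ → X ≃⋆ₐ[ℂ] X
  map_zero' : ∀ x, toFun 0 x = x
  map_add' : ∀ s t x, toFun (s + t) x = toFun s (toFun t x)
  continuous' : ∀ x, Continuous fun t => toFun t x

instance {X : Type*} [CStarAlgebra X] : CoeFun (CStarFlow X) fun _ => ℝ → X ≃⋆ₐ[ℂ] X :=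
  ⟨CStarFlow.toFun⟩

section KMS

variable {X : Type*} [CStarAlgebra X]

/-- The KMS condition at inverse temperature `β` on a ⋆-subalgebra `M`: the subalgebra `M` is norm
dense and `τ`-invariant, every `b ∈ M` is entire analytic for `τ`, that is, `t ↦ τ_t(b)` extends to
an entire function `z ↦ τ_z(b)`, and `ρ(a τ_{iβ}(b)) = ρ(b a)` for all `a, b ∈ M`. -/
structure KMSOn (τ : CStarFlow X) (β : ℝ) (ρ : CState X) (M : NonUnitalStarSubalgebra ℂ X) :
    Prop where
  dense : Dense (M : Set X)
  invariant : ∀ t, ∀ b ∈ M, τ t b ∈ M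
  kms : ∀ b ∈ M, ∃ f : ℂ → X, Differentiable ℂ f ∧ (∀ t : ℝ, f t = τ t b) ∧
    ∀ a ∈ M, ρ (a * f (Complex.I * β)) = ρ (b * a)

/-- `ρ` is a `τ`-KMS state at inverse temperature `β`. -/
def IsKMSState (τ : CStarFlow X) (β : ℝ) (ρ : CState X) : Prop :=
  ∃ M : NonUnitalStarSubalgebra ℂ X, KMSOn τ β ρ M

end KMS

section Product

variable {ι κ : Type} [Fintype ι] [Fintype κ] {A : Matrix ι ι ℕ} {B : Matrix κ κ ℕ}

/-- The state `ρ₁ ⊗_φ ρ₂ = (ρ₁ ⊗ ρ₂) ∘ φ_{A,B}`. -/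
def phiTensor (ρ₁ : CState (CKAlg A)) (ρ₂ : CState (CKAlg B)) : CState (CKAlg (A ⊗ₖ B)) :=
  (ρ₁.tensor ρ₂).comp (ckPhi A B)

/-- The ⋆-homomorphism `α¹_s ⊗ α²_t` of the minimal tensor product. -/
def flowTensor {X Y : Type u} [CStarAlgebra X] [CStarAlgebra Y] (α₁ : CStarFlow X)
    (α₂ : CStarFlow Y) (s t : ℝ) : MinTensor X Y →⋆ₐ[ℂ] MinTensor X Y :=
  MinTensor.map (α₁ s : X →⋆ₐ[ℂ] X) (α₂ t : Y →⋆ₐ[ℂ] Y)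

end Product

end KMSProduct

end

/-!
# Product KMS states on Cuntz–Krieger algebras

The ⋆-homomorphism `φ : 𝒪_{A ⊠ B} → 𝒪_A ⊗ 𝒪_B` is injective for all nondegenerate `A` and `B`, by
the gauge-invariant uniqueness theorem (`injective_of_gauge_invariant`). The kernel of `φ` is
invariant under the gauge action, because `φ` intertwines it with the gauge action on the first
tensor factor, and `φ` kills no generator, because nondegenerate matrices have Cuntz–Krieger
families of nonzero operators (`exists_ckRep_ne_zero`). The uniqueness theorem itself rests on two
facts. First, a ⋆-homomorphism that kills no generator is isometric on the gauge-invariant core,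
the closure of the union of the increasing ⋆-subalgebras `core n`
(`IsCKFamily.norm_map_of_mem_closure_core`). Second, the average over the gauge action takes values in
the core (`gaugeAvg_mem_closure_core`) and is faithful (`eq_zero_of_gaugeAvg_star_mul_self`).

Since `φ` is isometric, its range is closed, so the invariance of `φ(C)` under
`Θ_t = α¹_{β₁t} ⊗ α²_{β₂t}` passes to the whole range, and `Θ` restricts to a flow on `𝒪_{A ⊠ B}`.
If `f` and `g` continue the orbits of `a` and `b` analytically, then `z ↦ f(β₁z) ⊗ g(β₂z)` continues
the orbit of `a ⊗ b`, and the two KMS conditions multiply to the one for the product state at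
`z = i` (`exists_entire_of_mem_algTensor`). For `x ∈ C` the continuation of the orbit of `φ(x)` maps
the real line into the range of `φ`, hence the whole plane, by the identity theorem modulo the
closed range, and it lifts to an entire function in `𝒪_{A ⊠ B}` (`exists_entire_lift`). So the KMS
condition holds on `C` itself.

For the canonical subalgebras, the invariance of `φ(C)` reduces to the statement that an element of
the range of `φ` in the algebraic tensor product `B₁ ⊙ B₂` is already in `φ(C)`
(`mem_phiCanonical_of_mem_algTensor`). Such an element is fixed by the circle action
`γ_z ⊗ γ_{z⁻¹}`, so it equals its average, a combination of tensors `s_μ s_ν* ⊗ t_μ' t_ν'*` whose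
two factors have the same degree; expanding the shorter factor by `∑ sᵢsᵢ* = 1` shows that these lie
in `φ(C)`.
-/

noncomputable section

namespace KMSProduct

universe u

/-! ### Words in the generators -/

section Words

variable {ι : Type} {D : Type*} [CStarAlgebra D] {s : ι → D}

/-- The product `s_μ` of the generators along a word `μ`. -/
def word (s : ι → D) (μ : List ι) : D := (μ.map s).prod

@[simp] theorem word_nil : word s [] = 1 := rfl

@[simp] theorem word_cons (i : ι) (μ : List ι) : word s (i :: μ) = s i * word s μ := by
  simp [word]

theorem word_append (μ ν : List ι) : word s (μ ++ ν) = word s μ * word s ν := by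
  simp [word]

variable (s) in
/-- The span of the elements `s_μ s_ν*`. -/
def wordSpan : Submodule ℂ D :=
  Submodule.span ℂ (Set.range fun p : List ι × List ι => word s p.1 * star (word s p.2))

theorem word_mem_wordSpan (μ ν : List ι) : word s μ * star (word s ν) ∈ wordSpan s :=
  Submodule.subset_span ⟨(μ, ν), rfl⟩

theorem gen_mul_mem_wordSpan (i : ι) {x : D} (hx : x ∈ wordSpan s) : s i * x ∈ wordSpan s := by
  refine Submodule.span_induction ?_ (by simp) (fun x y _ _ hx hy => ?_) (fun c x _ hx => ?_) hx
  · rintro _ ⟨⟨μ, ν⟩, rfl⟩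
    rw [← mul_assoc, ← word_cons]
    exact word_mem_wordSpan _ _
  · rw [mul_add]; exact add_mem hx hy
  · rw [mul_smul_comm]; exact Submodule.smul_mem _ _ hx

end Words

/-! ### Relations between the generators -/

section Relations

variable {ι : Type} [Fintype ι] {A : Matrix ι ι ℕ} {D : Type*} [CStarAlgebra D] {s : ι → D}

namespace IsCKFamily

theorem range_mul_self (h : IsCKFamily A s) (i : ι) :
    s i * star (s i) * (s i * star (s i)) = s i * star (s i) := by
  rw [← mul_assoc, h.partialIsometry]

attribute [local instance] CStarAlgebra.spectralOrder CStarAlgebra.spectralOrderedRing in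
/-- Projections with sum `1` are pairwise orthogonal: compressing `∑ Pⱼ = 1` by `Pᵢ` gives
`∑_{j ≠ i} PᵢPⱼPᵢ = 0`, a sum of positive elements. -/
theorem range_mul_range (h : IsCKFamily A s) {i j : ι} (hij : i ≠ j) :
    s i * star (s i) * (s j * star (s j)) = 0 := by
  classical
  set P : ι → D := fun i => s i * star (s i) with hP
  have hstar (i : ι) : star (P i) = P i := by simp [hP]
  have hsq (i : ι) : P i * P i = P i := h.range_mul_self i
  have hsum : ∑ k, P j * P k * P j = P j := by
    rw [← Finset.sum_mul, ← Finset.mul_sum, show ∑ k, P k = 1 from h.sum_range, mul_one, hsq]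
  have hsum' : ∑ k ∈ Finset.univ.erase j, P j * P k * P j = 0 := by
    rw [← Finset.add_sum_erase _ _ (Finset.mem_univ j), hsq, hsq] at hsum
    simpa using hsum
  have hform (k : ι) : P j * P k * P j = star (P k * P j) * (P k * P j) := by
    rw [star_mul, hstar, hstar, mul_assoc (P j), mul_assoc (P j), ← mul_assoc (P k) (P k), hsq]
  have h0 := (Finset.sum_eq_zero_iff_of_nonneg fun k _ => by
    rw [hform]; exact star_mul_self_nonneg _).1 hsum' i
    (Finset.mem_erase.2 ⟨hij, Finset.mem_univ _⟩)
  rwa [hform, CStarRing.star_mul_self_eq_zero_iff] at h0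

theorem range_mul (h : IsCKFamily A s) [DecidableEq ι] (i j : ι) :
    s i * star (s i) * s j = if i = j then s j else 0 := by
  split_ifs with hij
  · rw [hij, h.partialIsometry]
  · rw [← h.partialIsometry j, ← mul_assoc, h.range_mul_range hij, zero_mul]

theorem star_mul_of_ne (h : IsCKFamily A s) {i j : ι} (hij : i ≠ j) : star (s i) * s j = 0 := by
  classical
  have h1 : star (s i) = star (s i) * (s i * star (s i)) := by
    conv_lhs => rw [← h.partialIsometry i]
    simp [mul_assoc]
  rw [h1, mul_assoc, h.range_mul, if_neg hij, mul_zero]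

theorem star_mul_mul (h : IsCKFamily A s) [DecidableEq ι] (i j : ι) (x : D) :
    star (s i) * (s j * x) = if i = j then ∑ k, A i k • (s k * star (s k)) * x else 0 := by
  split_ifs with hij
  · rw [← hij, ← mul_assoc, h.source, Finset.sum_mul]
  · rw [← mul_assoc, h.star_mul_of_ne hij, zero_mul]

theorem sum_mul_star_mul (h : IsCKFamily A s) (x : D) : ∑ i, s i * (star (s i) * x) = x := by
  simp_rw [← mul_assoc, ← Finset.sum_mul, h.sum_range, one_mul]

/-- An element is determined by its compressions `sᵢ* x sⱼ`. -/
theorem sum_compress (h : IsCKFamily A s) (x : D) :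
    ∑ i, ∑ j, s i * (star (s i) * x * s j) * star (s j) = x := by
  have h1 (i : ι) : ∑ j, s i * (star (s i) * x * s j) * star (s j) = s i * (star (s i) * x) := by
    simp_rw [mul_assoc, ← Finset.mul_sum, h.sum_range, mul_one]
  simp_rw [h1, h.sum_mul_star_mul]

/-! ### The gauge-invariant core -/

/-- The ⋆-homomorphism `c ↦ ∑ cᵢ sᵢsᵢ*` onto the span of the range projections. -/
def diag (h : IsCKFamily A s) : (ι → ℂ) →⋆ₐ[ℂ] D where
  toFun c := ∑ i, c i • (s i * star (s i))
  map_one' := by simp [h.sum_range]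
  map_zero' := by simp
  map_add' c d := by simp [add_smul, Finset.sum_add_distrib]
  map_mul' c d := by
    classical
    simp_rw [Finset.sum_mul_sum, smul_mul_smul_comm]
    refine Finset.sum_congr rfl fun i _ => ?_
    rw [Finset.sum_eq_single i (fun j _ hj => by rw [h.range_mul_range hj.symm, smul_zero])
      (by simp), h.range_mul_self]
    rfl
  commutes' r := by
    simp only [Pi.algebraMap_apply, Algebra.algebraMap_self, RingHom.id_apply]
    rw [← Finset.smul_sum, h.sum_range, Algebra.algebraMap_eq_smul_one]
  map_star' c := by simp [star_sum, star_smul]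

theorem diag_apply (h : IsCKFamily A s) (c : ι → ℂ) :
    h.diag c = ∑ i, c i • (s i * star (s i)) := rfl

theorem source_mem_range_diag (h : IsCKFamily A s) (i : ι) : star (s i) * s i ∈ h.diag.range :=
  ⟨fun j => (A i j : ℂ), by
    rw [h.source]
    exact Finset.sum_congr rfl fun j _ => Nat.cast_smul_eq_nsmul ℂ _ _⟩

theorem diag_mul (h : IsCKFamily A s) (c : ι → ℂ) (i : ι) : h.diag c * s i = c i • s i := by
  classical
  simp_rw [diag_apply, Finset.sum_mul, smul_mul_assoc, h.range_mul]
  simp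

/-- The elements `x` all of whose compressions `sᵢ* x sⱼ` lie in `S`. -/
def compressIn (h : IsCKFamily A s) (S : StarSubalgebra ℂ D) (hS : h.diag.range ≤ S) :
    StarSubalgebra ℂ D where
  carrier := {x | ∀ i j, star (s i) * x * s j ∈ S}
  mul_mem' := fun {x y} hx hy i j => by
    have h1 : star (s i) * (x * y) * s j =
        ∑ k, (star (s i) * x * s k) * (star (s k) * y * s j) := by
      have h2 : x * y = ∑ k, x * (s k * star (s k)) * y := by
        rw [← Finset.sum_mul, ← Finset.mul_sum, h.sum_range, mul_one]
      rw [h2, Finset.mul_sum, Finset.sum_mul]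
      simp only [mul_assoc]
    rw [h1]
    exact sum_mem fun k _ => mul_mem (hx i k) (hy k j)
  add_mem' := fun {x y} hx hy i j => by
    rw [mul_add, add_mul]; exact add_mem (hx i j) (hy i j)
  algebraMap_mem' := fun r i j => by
    rw [Algebra.algebraMap_eq_smul_one, mul_smul_comm, smul_mul_assoc, mul_one]
    refine SMulMemClass.smul_mem r ?_
    by_cases hij : i = j
    · subst hij
      exact hS (h.source_mem_range_diag i)
    · rw [h.star_mul_of_ne hij]; exact zero_mem _
  star_mem' := fun {x} hx i j => by
    have := star_mem (hx j i)
    simpa [mul_assoc] using this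

theorem range_diag_le_compressIn (h : IsCKFamily A s) (S : StarSubalgebra ℂ D)
    (hS : h.diag.range ≤ S) : h.diag.range ≤ h.compressIn S hS := by
  rintro _ ⟨c, rfl⟩ i j
  refine hS ?_
  change star (s i) * h.diag c * s j ∈ _
  rw [mul_assoc, h.diag_mul, mul_smul_comm]
  refine SMulMemClass.smul_mem _ ?_
  by_cases hij : i = j
  · subst hij
    exact h.source_mem_range_diag i
  · rw [h.star_mul_of_ne hij]; exact zero_mem _

/-- The finite stages of the gauge-invariant core, together with the fact that they contain the
span of the range projections. -/
def coreAux (h : IsCKFamily A s) : ℕ → {S : StarSubalgebra ℂ D // h.diag.range ≤ S}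
  | 0 => ⟨h.diag.range, le_rfl⟩
  | n + 1 => ⟨h.compressIn (coreAux h n).1 (coreAux h n).2,
      h.range_diag_le_compressIn (coreAux h n).1 (coreAux h n).2⟩

/-- The finite stages of the gauge-invariant core, described by compressions: stage `0` is the
span of the range projections, and `x` belongs to stage `n + 1` if every `sᵢ* x sⱼ` belongs to
stage `n`. Equivalently, stage `n` is the span of the `s_μ d s_ν*` with `|μ| = |ν| = n` and
`d` in stage `0`. -/
def core (h : IsCKFamily A s) (n : ℕ) : StarSubalgebra ℂ D := (h.coreAux n).1

theorem range_diag_le_core (h : IsCKFamily A s) (n : ℕ) : h.diag.range ≤ h.core n :=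
  (h.coreAux n).2

theorem mem_core_zero (h : IsCKFamily A s) {x : D} : x ∈ h.core 0 ↔ ∃ c, h.diag c = x := Iff.rfl

theorem mem_core_succ (h : IsCKFamily A s) {n : ℕ} {x : D} :
    x ∈ h.core (n + 1) ↔ ∀ i j, star (s i) * x * s j ∈ h.core n := Iff.rfl

theorem core_mono (h : IsCKFamily A s) : Monotone h.core := by
  refine monotone_nat_of_le_succ fun n => ?_
  induction n with
  | zero => exact h.range_diag_le_core 1
  | succ n ih => exact fun x hx i j => ih (hx i j)

theorem isClosed_core (h : IsCKFamily A s) (n : ℕ) : IsClosed (h.core n : Set D) := by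
  induction n with
  | zero =>
    have : (h.core 0 : Set D) = (LinearMap.range (h.diag : (ι → ℂ) →ₗ[ℂ] D) : Set D) := rfl
    rw [this]
    exact Submodule.closed_of_finiteDimensional _
  | succ n ih =>
    have : (h.core (n + 1) : Set D) = ⋂ i, ⋂ j, (fun x => star (s i) * x * s j) ⁻¹' h.core n := by
      ext x
      simp [h.mem_core_succ]
    rw [this]
    exact isClosed_iInter fun i => isClosed_iInter fun j => ih.preimage (by fun_prop)

/-- A ⋆-homomorphism that kills none of the generators is injective on each stage of the core. -/
theorem eq_zero_of_mem_core (h : IsCKFamily A s) {E : Type*} [CStarAlgebra E] (f : D →⋆ₐ[ℂ] E)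
    (hf : ∀ i, f (s i) ≠ 0) {n : ℕ} {x : D} (hx : x ∈ h.core n) (hfx : f x = 0) : x = 0 := by
  induction n generalizing x with
  | zero =>
    obtain ⟨c, rfl⟩ := h.mem_core_zero.1 hx
    have hc : c = 0 := funext fun i => by
      have h1 : f (h.diag c * s i) = 0 := by rw [map_mul, hfx, zero_mul]
      rw [h.diag_mul, map_smul] at h1
      exact (smul_eq_zero.1 h1).resolve_right (hf i)
    rw [hc, map_zero]
  | succ n ih =>
    rw [← h.sum_compress x]
    refine Finset.sum_eq_zero fun i _ => Finset.sum_eq_zero fun j _ => ?_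
    rw [ih (hx i j) (by rw [map_mul, map_mul, hfx, mul_zero, zero_mul]), mul_zero, zero_mul]

/-- A ⋆-homomorphism that kills none of the generators is isometric on the closure of the union of
the stages of the core, because an injective ⋆-homomorphism of C⋆-algebras is isometric. -/
theorem norm_map_of_mem_closure_core (h : IsCKFamily A s) {E : Type*} [CStarAlgebra E]
    (f : D →⋆ₐ[ℂ] E) (hf : ∀ i, f (s i) ≠ 0) {x : D}
    (hx : x ∈ closure (⋃ n, (h.core n : Set D))) : ‖f x‖ = ‖x‖ := by
  have hcont : Continuous f := AddMonoidHomClass.continuous_of_bound f 1 fun x => by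
    simpa using NonUnitalStarAlgHom.norm_apply_le f x
  have hcl : IsClosed {x : D | ‖f x‖ = ‖x‖} := isClosed_eq hcont.norm continuous_norm
  refine closure_minimal (fun y hy => ?_) hcl hx
  obtain ⟨n, hn⟩ := Set.mem_iUnion.1 hy
  have := h.isClosed_core n
  let g : h.core n →⋆ₐ[ℂ] E := f.comp (h.core n).subtype
  have hg : Function.Injective g := (injective_iff_map_eq_zero g).2 fun z hz =>
    Subtype.ext (h.eq_zero_of_mem_core f hf z.2 hz)
  exact NonUnitalStarAlgHom.norm_map g hg ⟨y, hn⟩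

/-! ### The span of the words -/

theorem star_gen_mul_mem_wordSpan (h : IsCKFamily A s) (i : ι) {x : D} (hx : x ∈ wordSpan s) :
    star (s i) * x ∈ wordSpan s := by
  classical
  refine Submodule.span_induction ?_ (by simp) (fun x y _ _ hx hy => ?_) (fun c x _ hx => ?_) hx
  · rintro _ ⟨⟨μ, ν⟩, rfl⟩
    cases μ with
    | nil =>
      have : star (s i) * (word s [] * star (word s ν)) =
          word s [] * star (word s (ν ++ [i])) := by simp [word_append]
      rw [this]
      exact word_mem_wordSpan _ _
    | cons j μ =>
      change star (s i) * (word s (j :: μ) * star (word s ν)) ∈ wordSpan s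
      rw [word_cons, mul_assoc, h.star_mul_mul]
      split_ifs with hij
      · refine sum_mem fun k _ => ?_
        rw [smul_mul_assoc]
        refine nsmul_mem ?_ _
        cases μ with
        | nil =>
          have : s k * star (s k) * (word s [] * star (word s ν)) =
              word s [k] * star (word s (ν ++ [k])) := by simp [word_append, mul_assoc]
          rw [this]
          exact word_mem_wordSpan _ _
        | cons m μ =>
          rw [word_cons, ← mul_assoc, ← mul_assoc, h.range_mul]
          split_ifs
          · rw [← word_cons]; exact word_mem_wordSpan _ _
          · simp
      · exact zero_mem _
  · rw [mul_add]; exact add_mem hx hy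
  · rw [mul_smul_comm]; exact Submodule.smul_mem _ _ hx

/-- The elements `s_μ s_ν*` span the unital ⋆-subalgebra generated by a Cuntz–Krieger family. -/
theorem mem_wordSpan_of_mem_adjoin (h : IsCKFamily A s) {x : D}
    (hx : x ∈ StarAlgebra.adjoin ℂ (Set.range s)) : x ∈ wordSpan s := by
  -- The span is stable under left multiplication by the generators and their adjoints, and it
  -- contains `1`.
  have key : ∀ y ∈ wordSpan s, x * y ∈ wordSpan s := by
    change x ∈ Algebra.adjoin ℂ (Set.range s ∪ star (Set.range s)) at hx
    induction hx using Algebra.adjoin_induction with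
    | mem x hx =>
      rcases hx with ⟨i, rfl⟩ | ⟨i, hi⟩
      · exact fun y hy => gen_mul_mem_wordSpan i hy
      · rw [← star_star x, ← hi]
        exact fun y hy => h.star_gen_mul_mem_wordSpan i hy
    | algebraMap r =>
      intro y hy
      rw [← Algebra.smul_def]
      exact Submodule.smul_mem _ _ hy
    | add x z _ _ hx hz =>
      intro y hy
      rw [add_mul]; exact add_mem (hx y hy) (hz y hy)
    | mul x z _ _ hx hz =>
      intro y hy
      rw [mul_assoc]; exact hx _ (hz y hy)
  simpa using key 1 (by simpa using word_mem_wordSpan (s := s) [] [])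

theorem word_mul_star_word_mem_core (h : IsCKFamily A s) {μ ν : List ι}
    (hμν : μ.length = ν.length) : word s μ * star (word s ν) ∈ h.core μ.length := by
  induction μ generalizing ν with
  | nil =>
    rw [List.length_nil, eq_comm, List.length_eq_zero_iff] at hμν
    subst hμν
    simp
  | cons m μ ih =>
    cases ν with
    | nil => simp at hμν
    | cons n ν =>
      rw [List.length_cons, h.mem_core_succ]
      intro i j
      have hQ (i m : ι) : star (s i) * s m ∈ h.core μ.length := by
        by_cases him : i = m
        · rw [him]; exact h.range_diag_le_core _ (h.source_mem_range_diag m)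
        · rw [h.star_mul_of_ne him]; exact zero_mem _
      have : star (s i) * (word s (m :: μ) * star (word s (n :: ν))) * s j =
          (star (s i) * s m) * (word s μ * star (word s ν)) * (star (s n) * s j) := by
        simp [mul_assoc]
      rw [this]
      exact mul_mem (mul_mem (hQ i m) (ih (by simpa using hμν))) (hQ n j)

end IsCKFamily
end Relations

/-! ### Universal properties of the Cuntz–Krieger algebra -/

theorem continuous_starAlgHom {X Y : Type*} [CStarAlgebra X] [CStarAlgebra Y] (f : X →⋆ₐ[ℂ] Y) :
    Continuous f :=
  AddMonoidHomClass.continuous_of_bound f 1 fun x => by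
    simpa using NonUnitalStarAlgHom.norm_apply_le f x

section Universal

variable {ι : Type} [Fintype ι] (A : Matrix ι ι ℕ)

theorem adjoin_ckGen_le_canonicalSubalgebra {x : CKAlg A}
    (hx : x ∈ StarAlgebra.adjoin ℂ (Set.range (ckGen A))) : x ∈ canonicalSubalgebra A := by
  have hg (i : ι) : ckGen A i ∈ canonicalSubalgebra A :=
    NonUnitalStarAlgebra.subset_adjoin ℂ _ ⟨i, rfl⟩
  have h1 : (1 : CKAlg A) ∈ canonicalSubalgebra A := by
    rw [← (isCKFamily_ckGen A).sum_range]
    exact sum_mem fun i _ => mul_mem (hg i) (star_mem (hg i))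
  change x ∈ Algebra.adjoin ℂ _ at hx
  induction hx using Algebra.adjoin_induction with
  | mem x hx =>
    rcases hx with ⟨i, rfl⟩ | ⟨i, hi⟩
    · exact hg i
    · rw [← star_star x, ← hi]
      exact star_mem (hg i)
  | algebraMap r =>
    rw [Algebra.algebraMap_eq_smul_one]
    exact SMulMemClass.smul_mem r h1
  | add x z _ _ hx hz => exact add_mem hx hz
  | mul x z _ _ hx hz => exact mul_mem hx hz

theorem mem_adjoin_of_mem_canonicalSubalgebra {x : CKAlg A} (hx : x ∈ canonicalSubalgebra A) :
    x ∈ StarAlgebra.adjoin ℂ (Set.range (ckGen A)) :=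
  NonUnitalStarAlgebra.adjoin_le_starAlgebra_adjoin ℂ _ hx

theorem isometry_ckIncl : Isometry (CKAlg.incl A) :=
  AddMonoidHomClass.isometry_of_norm (CKAlg.incl A) (CKAlg.norm_equiv A)

/-- The canonical generators generate a dense ⋆-subalgebra. -/
theorem dense_adjoin_ckGen :
    Dense (StarAlgebra.adjoin ℂ (Set.range (ckGen A)) : Set (CKAlg A)) := by
  rw [(isometry_ckIncl A).isEmbedding.isInducing.dense_iff]
  intro x
  have h1 : CKAlg.incl A '' (StarAlgebra.adjoin ℂ (Set.range (ckGen A)) : Set (CKAlg A)) =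
      StarAlgebra.adjoin ℂ (Set.range (univFamily A)) := by
    rw [← StarSubalgebra.coe_map, StarAlgHom.map_adjoin, ← Set.range_comp]
    congr 3
    exact funext fun i => CKAlg.incl_ckGen A i
  rw [h1, ← StarSubalgebra.topologicalClosure_coe]
  exact (CKAlg.equiv A x).2

theorem dense_canonicalSubalgebra : Dense (canonicalSubalgebra A : Set (CKAlg A)) :=
  (dense_adjoin_ckGen A).mono fun _ hx => adjoin_ckGen_le_canonicalSubalgebra A hx

theorem starAlgHom_ext_of_ckGen {E : Type*} [CStarAlgebra E] {f g : CKAlg A →⋆ₐ[ℂ] E}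
    (h : ∀ i, f (ckGen A i) = g (ckGen A i)) : f = g := by
  have h1 : StarAlgebra.adjoin ℂ (Set.range (ckGen A)) ≤ StarAlgHom.equalizer f g :=
    StarAlgHom.adjoin_le_equalizer f g (by rintro _ ⟨i, rfl⟩; exact h i)
  exact DFunLike.coe_injective (Continuous.ext_on (dense_adjoin_ckGen A) (continuous_starAlgHom f)
    (continuous_starAlgHom g) fun x hx => h1 hx)

/-- The representation of `𝒪_A` given by a Cuntz–Krieger family of operators. -/
def ckEval (r : CKRep A) : CKAlg A →⋆ₐ[ℂ] (r.H →L[ℂ] r.H) :=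
  (CKAmbient.eval A r).comp (CKAlg.incl A)

theorem ckEval_ckGen (r : CKRep A) (i : ι) : ckEval A r (ckGen A i) = r.t i := by
  change CKAmbient.eval A r (CKAlg.incl A (ckGen A i)) = _
  rw [CKAlg.incl_ckGen]
  rfl

theorem eq_zero_of_ckEval {x : CKAlg A} (h : ∀ r, ckEval A r x = 0) : x = 0 := by
  have h1 : CKAlg.incl A x = 0 := CKAmbient.ext A fun r => (h r).trans (map_zero _).symm
  exact (isometry_ckIncl A).injective (h1.trans (map_zero _).symm)

/-! ### The gauge action -/

variable {A} in
theorem IsCKFamily.circle_smul {D : Type*} [CStarAlgebra D] {s : ι → D} (h : IsCKFamily A s)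
    (z : Circle) : IsCKFamily A fun i => (z : ℂ) • s i := by
  have h1 : (z : ℂ) * star (z : ℂ) = 1 := by
    rw [Complex.star_def, Complex.mul_conj]; simp
  have h2 : star (z : ℂ) * (z : ℂ) = 1 := by rw [mul_comm, h1]
  constructor
  · intro i
    rw [star_smul, smul_mul_smul_comm, h1, one_smul, mul_smul_comm, h.partialIsometry]
  · intro i
    simp_rw [star_smul, smul_mul_smul_comm, h1, h2, one_smul, h.source]
  · simp_rw [star_smul, smul_mul_smul_comm, h1, one_smul, h.sum_range]

variable {A} in
/-- The Cuntz–Krieger family obtained from another one by multiplying all operators by `z`. -/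
abbrev CKRep.smul (r : CKRep A) (z : Circle) : CKRep A where
  H := r.H
  t := fun i => (z : ℂ) • r.t i
  isCK := r.isCK.circle_smul z

/-- The map of bounded families induced by multiplying Cuntz–Krieger families by `z`. -/
def gaugePullback (z : Circle) : CKAmbient A →⋆ₐ[ℂ] CKAmbient A where
  toFun x := ⟨fun r => x (r.smul z), memℓp_infty_iff.2 <| by
    obtain ⟨C, hC⟩ := (lp.memℓp x).bddAbove
    exact ⟨C, by rintro _ ⟨r, rfl⟩; exact hC ⟨r.smul z, rfl⟩⟩⟩
  map_one' := rfl
  map_mul' _ _ := rfl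
  map_zero' := rfl
  map_add' _ _ := rfl
  commutes' _ := rfl
  map_star' _ := rfl

theorem gaugePullback_univFamily (z : Circle) (i : ι) :
    gaugePullback A z (univFamily A i) = (z : ℂ) • univFamily A i := rfl

/-- The gauge action of the circle on `𝒪_A`, given by `sᵢ ↦ z sᵢ`. -/
def gauge (z : Circle) : CKAlg A →⋆ₐ[ℂ] CKAlg A :=
  ((CKAlg.equiv A).symm : CKUniv A →⋆ₐ[ℂ] CKAlg A).comp
    (StarAlgHom.codRestrict ((gaugePullback A z).comp (CKAlg.incl A)) (CKUniv A) fun x =>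
      map_mem_of_mem_cstarGen (W := CKAmbient A) (V := CKAmbient A) (gaugePullback A z)
        (T := CKUniv A) inferInstance
        (by
          rintro _ ⟨i, rfl⟩
          exact SMulMemClass.smul_mem (s := CKUniv A) (z : ℂ)
            (subset_cstarGen (Set.range (univFamily A)) ⟨i, rfl⟩))
        (CKAlg.equiv A x).2)

theorem gauge_ckGen (z : Circle) (i : ι) : gauge A z (ckGen A i) = (z : ℂ) • ckGen A i := by
  apply (isometry_ckIncl A).injective
  rw [map_smul, CKAlg.incl_ckGen]
  have h1 : CKAlg.incl A (gauge A z (ckGen A i)) =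
      gaugePullback A z (CKAlg.incl A (ckGen A i)) :=
    congrArg Subtype.val ((CKAlg.equiv A).apply_symm_apply _)
  rw [h1, CKAlg.incl_ckGen, gaugePullback_univFamily]

theorem gauge_one (x : CKAlg A) : gauge A 1 x = x := by
  have : gauge A 1 = StarAlgHom.id ℂ (CKAlg A) :=
    starAlgHom_ext_of_ckGen A fun i => by simp [gauge_ckGen]
  rw [this]; rfl

theorem gauge_word (z : Circle) (μ : List ι) :
    gauge A z (word (ckGen A) μ) = (z : ℂ) ^ μ.length • word (ckGen A) μ := by
  induction μ with
  | nil => simp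
  | cons i μ ih =>
    rw [word_cons, map_mul, ih, gauge_ckGen, smul_mul_smul_comm, List.length_cons, pow_succ']

theorem gauge_word_mul_star (z : Circle) (μ ν : List ι) :
    gauge A z (word (ckGen A) μ * star (word (ckGen A) ν)) =
      (z : ℂ) ^ (μ.length - ν.length : ℤ) • (word (ckGen A) μ * star (word (ckGen A) ν)) := by
  rw [map_mul, map_star, gauge_word, gauge_word, star_smul, smul_mul_smul_comm, star_pow,
    Complex.star_def, ← Circle.coe_inv_eq_conj, zpow_sub₀ (Circle.coe_ne_zero z), zpow_natCast,
    zpow_natCast, Circle.coe_inv, inv_pow, div_eq_mul_inv]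

/-- The points with continuous orbits under a family of contractions form a closed set, because a
uniform limit of continuous functions is continuous. -/
theorem isClosed_setOf_continuous_orbit {T X Y : Type*} [TopologicalSpace T]
    [PseudoMetricSpace X] [PseudoMetricSpace Y] {f : T → X → Y}
    (hf : ∀ t, LipschitzWith 1 (f t)) : IsClosed {x | Continuous fun t => f t x} := by
  refine isClosed_of_closure_subset fun x hx => ?_
  refine continuous_of_uniform_approx_of_continuous fun u hu => ?_
  obtain ⟨ε, hε, hεu⟩ := Metric.mem_uniformity_dist.1 hu
  obtain ⟨y, hy, hxy⟩ := Metric.mem_closure_iff.1 hx ε hε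
  refine ⟨_, hy, fun t => hεu (((hf t).dist_le_mul x y).trans_lt ?_)⟩
  simpa using hxy

theorem lipschitzWith_starAlgHom {X Y : Type*} [CStarAlgebra X] [CStarAlgebra Y]
    (f : X →⋆ₐ[ℂ] Y) : LipschitzWith 1 f :=
  AddMonoidHomClass.lipschitz_of_bound_nnnorm f 1 fun x => by
    simpa using NonUnitalStarAlgHom.nnnorm_apply_le f x

theorem continuous_gauge (x : CKAlg A) : Continuous fun z => gauge A z x := by
  have hcl := isClosed_setOf_continuous_orbit (f := fun z => gauge A z)
    fun z => lipschitzWith_starAlgHom (gauge A z)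
  refine hcl.closure_subset_iff.2 (fun y hy => ?_) (dense_adjoin_ckGen A x)
  change y ∈ Algebra.adjoin ℂ _ at hy
  change Continuous fun z => gauge A z y
  induction hy using Algebra.adjoin_induction with
  | mem y hy =>
    rcases hy with ⟨i, rfl⟩ | ⟨i, hi⟩
    · simp_rw [gauge_ckGen]; fun_prop
    · rw [← star_star y, ← hi]
      simp_rw [map_star, gauge_ckGen]; fun_prop
  | algebraMap r => simp_rw [AlgHomClass.commutes]; fun_prop
  | add x z _ _ hx hz => simp_rw [map_add]; exact hx.add hz
  | mul x z _ _ hx hz => simp_rw [map_mul]; exact hx.mul hz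

/-! ### Averaging over the circle -/

/-- The parametrisation `t ↦ e^{2πit}` of the circle. -/
def circleParam (t : ℝ) : Circle := Circle.exp (2 * Real.pi * t)

theorem continuous_circleParam : Continuous circleParam := by
  unfold circleParam; fun_prop

theorem circleParam_zero : circleParam 0 = 1 := by simp [circleParam]

theorem integral_circleParam_zpow_smul {Y : Type*} [NormedAddCommGroup Y] [NormedSpace ℂ Y]
    [CompleteSpace Y] (d : ℤ) (y : Y) :
    ∫ t in (0 : ℝ)..1, (circleParam t : ℂ) ^ d • y = if d = 0 then y else 0 := by
  split_ifs with hd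
  · simp [hd]
  · rw [intervalIntegral.integral_smul_const]
    have hc : (d * (2 * Real.pi * Complex.I) : ℂ) ≠ 0 :=
      mul_ne_zero (Int.cast_ne_zero.2 hd) Complex.two_pi_I_ne_zero
    have h1 (t : ℝ) : (circleParam t : ℂ) ^ d =
        Complex.exp (d * (2 * Real.pi * Complex.I) * t) := by
      rw [circleParam, Circle.coe_exp, ← Complex.exp_int_mul]
      congr 1
      push_cast
      ring
    simp_rw [h1]
    rw [integral_exp_mul_complex hc]
    simp [Complex.exp_int_mul_two_pi_mul_I]

/-- The average of the orbit of `x` under the gauge action. -/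
def gaugeAvg (x : CKAlg A) : CKAlg A := ∫ t in (0 : ℝ)..1, gauge A (circleParam t) x

theorem continuous_gauge_circleParam (x : CKAlg A) :
    Continuous fun t => gauge A (circleParam t) x :=
  (continuous_gauge A x).comp continuous_circleParam

theorem gaugeAvg_add (x y : CKAlg A) : gaugeAvg A (x + y) = gaugeAvg A x + gaugeAvg A y := by
  simp only [gaugeAvg, map_add]
  exact intervalIntegral.integral_add
    ((continuous_gauge_circleParam A x).intervalIntegrable _ _)
    ((continuous_gauge_circleParam A y).intervalIntegrable _ _)

theorem gaugeAvg_smul (c : ℂ) (x : CKAlg A) : gaugeAvg A (c • x) = c • gaugeAvg A x := by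
  simp only [gaugeAvg, map_smul]
  exact intervalIntegral.integral_smul c _

theorem norm_gaugeAvg_le (x : CKAlg A) : ‖gaugeAvg A x‖ ≤ ‖x‖ := by
  simpa [gaugeAvg] using intervalIntegral.norm_integral_le_of_norm_le_const (a := (0 : ℝ)) (b := 1)
    (C := ‖x‖) fun t _ => NonUnitalStarAlgHom.norm_apply_le (gauge A (circleParam t)) x

theorem continuous_gaugeAvg : Continuous (gaugeAvg A) := by
  let L : CKAlg A →ₗ[ℂ] CKAlg A :=
    { toFun := gaugeAvg A, map_add' := gaugeAvg_add A, map_smul' := gaugeAvg_smul A }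
  exact AddMonoidHomClass.continuous_of_bound L 1 fun x => by
    simpa [L] using norm_gaugeAvg_le A x

/-- Averages over the gauge action lie in the gauge-invariant core. -/
theorem gaugeAvg_mem_closure_core (x : CKAlg A) :
    gaugeAvg A x ∈ closure (⋃ n, ((isCKFamily_ckGen A).core n : Set (CKAlg A))) := by
  have hcl : IsClosed {x | gaugeAvg A x ∈
      closure (⋃ n, ((isCKFamily_ckGen A).core n : Set (CKAlg A)))} :=
    isClosed_closure.preimage (continuous_gaugeAvg A)
  refine hcl.closure_subset_iff.2 (fun y hy => subset_closure ?_) (dense_adjoin_ckGen A x)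
  rw [Set.mem_iUnion]
  refine Submodule.span_induction ?_ ⟨0, ?_⟩ (fun x y _ _ hx hy => ?_) (fun c x _ hx => ?_)
    ((isCKFamily_ckGen A).mem_wordSpan_of_mem_adjoin hy)
  · rintro _ ⟨⟨μ, ν⟩, rfl⟩
    simp only [gaugeAvg, gauge_word_mul_star, integral_circleParam_zpow_smul]
    split_ifs with hd
    · exact ⟨_, (isCKFamily_ckGen A).word_mul_star_word_mem_core (by omega)⟩
    · exact ⟨0, zero_mem _⟩
  · simp [gaugeAvg, zero_mem]
  · obtain ⟨m, hm⟩ := hx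
    obtain ⟨n, hn⟩ := hy
    refine ⟨max m n, ?_⟩
    rw [gaugeAvg_add]
    exact add_mem ((isCKFamily_ckGen A).core_mono (le_max_left m n) hm)
      ((isCKFamily_ckGen A).core_mono (le_max_right m n) hn)
  · obtain ⟨m, hm⟩ := hx
    refine ⟨m, ?_⟩
    rw [gaugeAvg_smul]
    exact SMulMemClass.smul_mem c hm

/-- Averaging over the gauge action is faithful: in a representation on `H` the average of
`⟨v, γ_z(x*x)v⟩ = ‖γ_z(x)v‖²` over the circle vanishes only if `xv = 0`. -/
theorem eq_zero_of_gaugeAvg_star_mul_self {x : CKAlg A} (h : gaugeAvg A (star x * x) = 0) :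
    x = 0 := by
  refine eq_zero_of_ckEval A fun r => ContinuousLinearMap.ext fun v => ?_
  let L : CKAlg A →L[ℂ] ℂ := ⟨
    { toFun := fun y => ⟪v, ckEval A r y v⟫_ℂ
      map_add' := fun y z => by rw [map_add, add_apply, inner_add_right]
      map_smul' := fun c y => by
        rw [map_smul, smul_apply, inner_smul_right]; rfl },
    continuous_const.inner ((continuous_starAlgHom (ckEval A r)).clm_apply continuous_const)⟩
  have hL (y : CKAlg A) : L (star y * y) = ((‖ckEval A r y v‖ ^ 2 : ℝ) : ℂ) := by
    change ⟪v, ckEval A r (star y * y) v⟫_ℂ = _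
    rw [map_mul, map_star, mul_apply_eq_comp, ContinuousLinearMap.star_eq_adjoint,
      ContinuousLinearMap.adjoint_inner_right, inner_self_eq_norm_sq_to_K]
    norm_cast
  have h1 : ∫ t in (0 : ℝ)..1, ‖ckEval A r (gauge A (circleParam t) x) v‖ ^ 2 = 0 := by
    have h2 : L (gaugeAvg A (star x * x)) = 0 := by rw [h, map_zero]
    rw [gaugeAvg, ← ContinuousLinearMap.intervalIntegral_comp_comm _
      ((continuous_gauge_circleParam A _).intervalIntegrable _ _)] at h2
    simp_rw [map_mul, map_star, hL] at h2
    rw [intervalIntegral.integral_ofReal] at h2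
    exact_mod_cast h2
  have hcont : Continuous fun t => ‖ckEval A r (gauge A (circleParam t) x) v‖ ^ 2 :=
    ((((continuous_starAlgHom (ckEval A r)).comp
      (continuous_gauge_circleParam A x)).clm_apply continuous_const).norm).pow 2
  by_contra hne
  have h0 : 0 < ‖ckEval A r (gauge A (circleParam 0) x) v‖ ^ 2 := by
    rw [circleParam_zero, gauge_one]
    exact pow_pos (norm_pos_iff.2 hne) 2
  exact (intervalIntegral.integral_pos zero_lt_one hcont.continuousOn
    (fun t _ => by positivity) ⟨0, by simp, h0⟩).ne' h1

/-- The gauge-invariant uniqueness theorem: a ⋆-homomorphism on `𝒪_A` that kills none of the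
generators and whose kernel is invariant under the gauge action is injective. -/
theorem injective_of_gauge_invariant {E : Type*} [CStarAlgebra E] (f : CKAlg A →⋆ₐ[ℂ] E)
    (hf : ∀ i, f (ckGen A i) ≠ 0) (hinv : ∀ z x, f x = 0 → f (gauge A z x) = 0) :
    Function.Injective f := by
  refine (injective_iff_map_eq_zero f).2 fun x hx => ?_
  refine eq_zero_of_gaugeAvg_star_mul_self A ?_
  rw [← norm_eq_zero, ← (isCKFamily_ckGen A).norm_map_of_mem_closure_core f hf
    (gaugeAvg_mem_closure_core A _), norm_eq_zero]
  let L : CKAlg A →L[ℂ] E := ⟨(f : CKAlg A →ₐ[ℂ] E).toLinearMap, continuous_starAlgHom f⟩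
  change L (gaugeAvg A (star x * x)) = 0
  rw [gaugeAvg, ← ContinuousLinearMap.intervalIntegral_comp_comm _
    ((continuous_gauge_circleParam A _).intervalIntegrable _ _)]
  have h1 (t : ℝ) : L (gauge A (circleParam t) (star x * x)) = 0 :=
    hinv _ _ (by rw [map_mul, hx, mul_zero])
  simp_rw [h1, intervalIntegral.integral_zero]

end Universal

/-! ### A Cuntz–Krieger family of nonzero operators -/

section Faithful

/-- The square summable functions on a set. -/
abbrev EllTwo (X : Type) : Type := lp (fun _ : X => ℂ) 2

/-- The standard basis of `ℓ²(X)`. -/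
def ellTwoBasis (X : Type) : HilbertBasis X ℂ (EllTwo X) := ⟨LinearIsometryEquiv.refl ℂ _⟩

theorem ellTwo_op_ext {X : Type} {S T : EllTwo X →L[ℂ] EllTwo X}
    (h : ∀ x, S (ellTwoBasis X x) = T (ellTwoBasis X x)) : S = T := by
  refine ContinuousLinearMap.ext_on (s := Set.range (ellTwoBasis X)) ?_
    (by rintro _ ⟨x, rfl⟩; exact h x)
  have := (ellTwoBasis X).dense_span
  rw [dense_iff_closure_eq, ← Submodule.topologicalClosure_coe, this]
  rfl

/-- The isometry of `ℓ²` spaces given by an injective map `f` sends `δ_y` to `δ_{f y}`. -/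
theorem exists_isometry_of_injective {X Y : Type} {f : Y → X} (hf : Function.Injective f) :
    ∃ V : EllTwo Y →L[ℂ] EllTwo X,
      (∀ v, ContinuousLinearMap.adjoint V (V v) = v) ∧
      (∀ y, V (ellTwoBasis Y y) = ellTwoBasis X (f y)) ∧
      (∀ x, x ∉ Set.range f → ContinuousLinearMap.adjoint V (ellTwoBasis X x) = 0) := by
  classical
  have hon : Orthonormal ℂ fun y => ellTwoBasis X (f y) := (ellTwoBasis X).orthonormal.comp f hf
  let V : EllTwo Y →ₗᵢ[ℂ] EllTwo X := hon.orthogonalFamily.linearIsometry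
  have hV (y : Y) : V (ellTwoBasis Y y) = ellTwoBasis X (f y) := by
    rw [← (ellTwoBasis Y).repr_symm_single y]
    exact (hon.orthogonalFamily.linearIsometry_apply_single (1 : ℂ)).trans (one_smul ℂ _)
  refine ⟨V.toContinuousLinearMap, fun v => ?_, hV, fun x hx => ?_⟩
  · refine ext_inner_right ℂ fun w => ?_
    rw [ContinuousLinearMap.adjoint_inner_left]
    exact V.inner_map_map v w
  · refine (ellTwoBasis Y).repr.injective (lp.ext (funext fun y => ?_))
    rw [(ellTwoBasis Y).repr_apply_apply, ContinuousLinearMap.adjoint_inner_right]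
    change ⟪V (ellTwoBasis Y y), ellTwoBasis X x⟫_ℂ = _
    rw [hV, map_zero]
    exact (ellTwoBasis X).orthonormal.2 fun h => hx ⟨y, h⟩

variable {ι : Type} [Fintype ι] {A : Matrix ι ι ℕ}

/-- A nondegenerate matrix has a Cuntz–Krieger family of nonzero operators. On `ℓ²(ι × ℕ)` let `Uᵢ`
be the isometry `δ_n ↦ δ_{(i, n)}` and `Wᵢ` an isometry that enumerates the basis vectors
`δ_{(j, n)}` with `a_{ij} = 1`, infinitely many because no row of `A` vanishes; then the operators
`UᵢWᵢ*` form such a family. -/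
theorem exists_ckRep_ne_zero [Nonempty ι] (hA : IsNondegenerate A) :
    ∃ r : CKRep A, ∀ i, r.t i ≠ 0 := by
  classical
  let b := ellTwoBasis (ι × ℕ)
  have hinf (i : ι) : Infinite {p : ι × ℕ // A i p.1 ≠ 0} := by
    obtain ⟨j, hj⟩ := hA.row i
    exact Infinite.of_injective (fun n : ℕ => (⟨(j, n), hj⟩ : {p : ι × ℕ // A i p.1 ≠ 0}))
      fun m n h => by simpa using h
  have he (i : ι) : ∃ e : ℕ → ι × ℕ, Function.Injective e ∧ Set.range e = {p | A i p.1 ≠ 0} := by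
    have := hinf i
    obtain ⟨e⟩ := nonempty_equiv_of_countable (α := ℕ) (β := {p : ι × ℕ // A i p.1 ≠ 0})
    exact ⟨fun n => e n, Subtype.val_injective.comp e.injective, by
      rw [show (fun n => (e n : ι × ℕ)) = Subtype.val ∘ e from rfl, e.surjective.range_comp]
      simp⟩
  choose e he hrange using he
  choose W hWiso hWb hWz using fun i => exists_isometry_of_injective (he i)
  choose U hUiso hUb hUz using fun i : ι =>
    exists_isometry_of_injective (f := fun n : ℕ => (i, n)) fun m n h => by simpa using h
  have hUU (i : ι) : U i ∘L (U i).adjoint ∘L U i = U i :=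
    ContinuousLinearMap.ext fun v => congrArg (U i) (hUiso i v)
  let t : ι → EllTwo (ι × ℕ) →L[ℂ] EllTwo (ι × ℕ) := fun i => U i ∘L (W i).adjoint
  have hstar (i : ι) : star (t i) = W i ∘L (U i).adjoint := by
    rw [ContinuousLinearMap.star_eq_adjoint, ContinuousLinearMap.adjoint_comp,
      ContinuousLinearMap.adjoint_adjoint]
  have hrange_apply (i : ι) (v : EllTwo (ι × ℕ)) :
      (t i * star (t i)) v = U i ((U i).adjoint v) := by
    rw [mul_apply_eq_comp, hstar]
    exact congrArg (U i) (hWiso i _)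
  have hsource_apply (i : ι) (v : EllTwo (ι × ℕ)) :
      (star (t i) * t i) v = W i ((W i).adjoint v) := by
    rw [mul_apply_eq_comp, hstar]
    exact congrArg (W i) (hUiso i _)
  have hUbasis (i j : ι) (n : ℕ) :
      U i ((U i).adjoint (b (j, n))) = if i = j then b (j, n) else 0 := by
    split_ifs with h
    · subst h
      rw [← hUb i n, hUiso]
    · rw [hUz i (j, n) (by rintro ⟨m, hm⟩; exact h (congrArg Prod.fst hm)), map_zero]
  have hWbasis (i j : ι) (n : ℕ) :
      W i ((W i).adjoint (b (j, n))) = A i j • b (j, n) := by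
    rcases hA.entries i j with h | h
    · rw [hWz i (j, n) (by rw [hrange]; simpa using h), map_zero, h, zero_smul]
    · obtain ⟨m, hm⟩ : (j, n) ∈ Set.range (e i) := by rw [hrange]; simp [h]
      rw [h, one_smul, ← hm, ← hWb i m, hWiso]
  have hCK : IsCKFamily A t :=
    { partialIsometry := fun i => ContinuousLinearMap.ext fun v => by
        rw [mul_apply_eq_comp, hrange_apply]
        exact congrArg (U i) (hUiso i _)
      source := fun i => ellTwo_op_ext fun ⟨j, n⟩ => by
        change (star (t i) * t i) (b (j, n)) = (∑ k, A i k • (t k * star (t k))) (b (j, n))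
        have h1 (k : ι) : (A i k • (t k * star (t k))) (b (j, n)) =
            A i k • if k = j then b (j, n) else 0 := by
          rw [smul_apply, hrange_apply, hUbasis]
        rw [hsource_apply, hWbasis, sum_apply, Finset.sum_congr rfl fun k _ => h1 k]
        simp
      sum_range := ellTwo_op_ext fun ⟨j, n⟩ => by
        change (∑ k, t k * star (t k)) (b (j, n)) = b (j, n)
        have h1 (k : ι) : (t k * star (t k)) (b (j, n)) = if k = j then b (j, n) else 0 := by
          rw [hrange_apply, hUbasis]
        rw [sum_apply, Finset.sum_congr rfl fun k _ => h1 k]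
        simp }
  have hne (p : ι × ℕ) : b p ≠ 0 := (ellTwoBasis (ι × ℕ)).orthonormal.ne_zero p
  have : Nontrivial (EllTwo (ι × ℕ)) := ⟨⟨b (Classical.arbitrary ι, 0), 0, hne _⟩⟩
  refine ⟨{ H := EllTwo (ι × ℕ), t := t, isCK := hCK }, fun i hi => hne (i, 0) ?_⟩
  have h1 : t i (W i (ellTwoBasis ℕ 0)) = b (i, 0) :=
    (congrArg (U i) (hWiso i _)).trans (hUb i 0)
  rw [← h1, show t i = 0 from hi, zero_apply]

end Faithful

/-! ### Elementary tensors -/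

section Tensor

variable {X Y X' Y' : Type u} [CStarAlgebra X] [CStarAlgebra Y] [CStarAlgebra X'] [CStarAlgebra Y']

theorem MinTensor.ext {x y : MinTensor X Y}
    (h : ∀ p, MinTensor.incl X Y x p = MinTensor.incl X Y y p) : x = y :=
  Subtype.ext (lp.ext (funext h))

theorem incl_tmul (a : X) (b : Y) (p : HRep X × HRep Y) :
    MinTensor.incl X Y (tmul a b) p = opTensor (p.1.π a) (p.2.π b) := rfl

theorem tmul_add_left (a a' : X) (b : Y) : tmul (a + a') b = tmul a b + tmul a' b :=
  MinTensor.ext fun p => by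
    rw [map_add, lp.coeFn_add, Pi.add_apply, incl_tmul, incl_tmul, incl_tmul, map_add,
      opTensor_add_left]

theorem tmul_add_right (a : X) (b b' : Y) : tmul a (b + b') = tmul a b + tmul a b' :=
  MinTensor.ext fun p => by
    rw [map_add, lp.coeFn_add, Pi.add_apply, incl_tmul, incl_tmul, incl_tmul, map_add,
      opTensor_add_right]

theorem tmul_smul_left (c : ℂ) (a : X) (b : Y) : tmul (c • a) b = c • tmul a b :=
  MinTensor.ext fun p => by
    rw [map_smul, lp.coeFn_smul, Pi.smul_apply, incl_tmul, incl_tmul, map_smul,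
      opTensor_smul_left]

theorem tmul_smul_right (c : ℂ) (a : X) (b : Y) : tmul a (c • b) = c • tmul a b :=
  MinTensor.ext fun p => by
    rw [map_smul, lp.coeFn_smul, Pi.smul_apply, incl_tmul, incl_tmul, map_smul,
      opTensor_smul_right]

theorem tmul_mul_tmul (a a' : X) (b b' : Y) :
    tmul a b * tmul a' b' = tmul (a * a') (b * b') :=
  MinTensor.ext fun p => by
    rw [map_mul, lp.infty_coeFn_mul, Pi.mul_apply, incl_tmul, incl_tmul, incl_tmul, map_mul,
      map_mul, opTensor_mul]

theorem star_tmul (a : X) (b : Y) : star (tmul a b) = tmul (star a) (star b) :=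
  MinTensor.ext fun p => by
    rw [map_star, lp.coeFn_star, Pi.star_apply, incl_tmul, incl_tmul, map_star, map_star,
      opTensor_star]

theorem tmul_one_one : (tmul 1 1 : MinTensor X Y) = 1 :=
  MinTensor.ext fun p => by
    rw [map_one, incl_tmul, map_one, map_one, opTensor_one]; rfl

theorem norm_tmul_le (a : X) (b : Y) : ‖tmul a b‖ ≤ ‖a‖ * ‖b‖ := by
  refine lp.norm_le_of_forall_le (by positivity) fun p => ?_
  refine (norm_opTensor_le _ _).trans ?_
  gcongr
  · exact NonUnitalStarAlgHom.norm_apply_le p.1.π a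
  · exact NonUnitalStarAlgHom.norm_apply_le p.2.π b

variable (X Y) in
/-- The bilinear map `(a, b) ↦ a ⊗ b`. -/
def tmulₗ : X →ₗ[ℂ] Y →ₗ[ℂ] MinTensor X Y :=
  LinearMap.mk₂ ℂ tmul tmul_add_left tmul_smul_left tmul_add_right tmul_smul_right

variable (X Y) in
/-- The continuous bilinear map `(a, b) ↦ a ⊗ b`. -/
def tmulL : X →L[ℂ] Y →L[ℂ] MinTensor X Y :=
  LinearMap.mkContinuous₂ (tmulₗ X Y) 1 fun a b => by
    rw [one_mul]; exact norm_tmul_le a b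

@[simp] theorem tmulₗ_apply (a : X) (b : Y) : tmulₗ X Y a b = tmul a b := rfl

@[simp] theorem tmulL_apply (a : X) (b : Y) : tmulL X Y a b = tmul a b := rfl

theorem opTensor_ne_zero {H K : Type*} [NormedAddCommGroup H] [InnerProductSpace ℂ H]
    [NormedAddCommGroup K] [InnerProductSpace ℂ K] {S : H →L[ℂ] H} {T : K →L[ℂ] K}
    (hS : S ≠ 0) (hT : T ≠ 0) : opTensor S T ≠ 0 := by
  obtain ⟨v, hv⟩ := DFunLike.ne_iff.1 hS
  obtain ⟨w, hw⟩ := DFunLike.ne_iff.1 hT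
  intro h
  have h1 : ‖opTensor S T (HTensor.of H K (v ⊗ₜ[ℂ] w))‖ = 0 := by rw [h]; simp
  rw [opTensor_of, LinearIsometry.norm_map, TensorProduct.mapL_tmul, TensorProduct.norm_tmul,
    mul_eq_zero, norm_eq_zero, norm_eq_zero] at h1
  exact h1.elim hv hw

variable {M : NonUnitalStarSubalgebra ℂ X} {N : NonUnitalStarSubalgebra ℂ Y}

theorem tmul_mem_algTensor {a : X} {b : Y} (ha : a ∈ M) (hb : b ∈ N) :
    tmul a b ∈ algTensor M N := Submodule.subset_span ⟨a, ha, b, hb, rfl⟩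

theorem map_mem_algTensor {f : X →⋆ₐ[ℂ] X} {g : Y →⋆ₐ[ℂ] Y} (hf : ∀ a ∈ M, f a ∈ M)
    (hg : ∀ b ∈ N, g b ∈ N) {z : MinTensor X Y} (hz : z ∈ algTensor M N) :
    MinTensor.map f g z ∈ algTensor M N := by
  refine Submodule.span_induction ?_ (by simp) (fun x y _ _ hx hy => ?_) (fun c x _ hx => ?_) hz
  · rintro _ ⟨a, ha, b, hb, rfl⟩
    rw [MinTensor.map_tmul]
    exact tmul_mem_algTensor (hf a ha) (hg b hb)
  · rw [map_add]; exact add_mem hx hy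
  · rw [map_smul]; exact Submodule.smul_mem _ _ hx

end Tensor

/-! ### Injectivity of `φ` -/

section Phi

variable {ι κ : Type} [Fintype ι] [Fintype κ] (A : Matrix ι ι ℕ) (B : Matrix κ κ ℕ)

variable {A B} in
theorem tmul_ckGen_ne_zero (hA : IsNondegenerate A) (hB : IsNondegenerate B) (i : ι) (j : κ) :
    tmul (ckGen A i) (ckGen B j) ≠ 0 := by
  have : Nonempty ι := ⟨i⟩
  have : Nonempty κ := ⟨j⟩
  obtain ⟨r, hr⟩ := exists_ckRep_ne_zero hA
  obtain ⟨r', hr'⟩ := exists_ckRep_ne_zero hB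
  let R : HRep (CKAlg A) := { H := r.H, π := ckEval A r }
  let R' : HRep (CKAlg B) := { H := r'.H, π := ckEval B r' }
  intro h
  have h1 : opTensor (R.π (ckGen A i)) (R'.π (ckGen B j)) = 0 := by
    rw [← incl_tmul (ckGen A i) (ckGen B j) (R, R'), h, map_zero]; rfl
  refine opTensor_ne_zero (S := R.π (ckGen A i)) (T := R'.π (ckGen B j)) ?_ ?_ h1
  · rw [show R.π (ckGen A i) = r.t i from ckEval_ckGen A r i]; exact hr i
  · rw [show R'.π (ckGen B j) = r'.t j from ckEval_ckGen B r' j]; exact hr' j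

theorem map_gauge_ckPhi (z : Circle) (x : CKAlg (A ⊗ₖ B)) :
    MinTensor.map (gauge A z) (StarAlgHom.id ℂ (CKAlg B)) (ckPhi A B x) =
      ckPhi A B (gauge (A ⊗ₖ B) z x) := by
  have : (MinTensor.map (gauge A z) (StarAlgHom.id ℂ (CKAlg B))).comp (ckPhi A B) =
      (ckPhi A B).comp (gauge (A ⊗ₖ B) z) :=
    starAlgHom_ext_of_ckGen _ fun q => by
      rw [StarAlgHom.comp_apply, StarAlgHom.comp_apply, gauge_ckGen, map_smul, ckPhi_ckGen,
        MinTensor.map_tmul, gauge_ckGen, tmul_smul_left]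
      rfl
  exact DFunLike.congr_fun this x

variable {A B} in
/-- For nondegenerate matrices `φ` is injective: it intertwines the gauge action with the gauge
action on the first tensor factor, and `sᵢ ⊗ sⱼ ≠ 0`. -/
theorem injective_ckPhi (hA : IsNondegenerate A) (hB : IsNondegenerate B) :
    Function.Injective (ckPhi A B) :=
  injective_of_gauge_invariant _ _
    (fun q => by rw [ckPhi_ckGen]; exact tmul_ckGen_ne_zero hA hB q.1 q.2)
    fun z x hx => by rw [← map_gauge_ckPhi, hx, map_zero]

/-! ### The image of the canonical subalgebra -/

theorem ckPhi_word (μ : List (ι × κ)) : ckPhi A B (word (ckGen (A ⊗ₖ B)) μ) =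
    tmul (word (ckGen A) (μ.map Prod.fst)) (word (ckGen B) (μ.map Prod.snd)) := by
  induction μ with
  | nil => simp [tmul_one_one]
  | cons q μ ih =>
    rw [word_cons, map_mul, ih, ckPhi_ckGen, tmul_mul_tmul, List.map_cons, List.map_cons,
      word_cons, word_cons]

theorem ckPhi_word_mul_star (μ ν : List (ι × κ)) :
    ckPhi A B (word (ckGen (A ⊗ₖ B)) μ * star (word (ckGen (A ⊗ₖ B)) ν)) =
      tmul (word (ckGen A) (μ.map Prod.fst) * star (word (ckGen A) (ν.map Prod.fst)))
        (word (ckGen B) (μ.map Prod.snd) * star (word (ckGen B) (ν.map Prod.snd))) := by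
  rw [map_mul, map_star, ckPhi_word, ckPhi_word, star_tmul, tmul_mul_tmul]

theorem word_mul_star_mem_canonicalSubalgebra (μ ν : List ι) :
    word (ckGen A) μ * star (word (ckGen A) ν) ∈ canonicalSubalgebra A := by
  have h (μ : List ι) : word (ckGen A) μ ∈ StarAlgebra.adjoin ℂ (Set.range (ckGen A)) := by
    refine list_prod_mem fun x hx => ?_
    obtain ⟨i, -, rfl⟩ := List.mem_map.1 hx
    exact StarAlgebra.subset_adjoin ℂ _ ⟨i, rfl⟩
  exact adjoin_ckGen_le_canonicalSubalgebra A (mul_mem (h μ) (star_mem (h ν)))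

theorem mem_wordSpan_of_mem_canonicalSubalgebra {x : CKAlg A} (hx : x ∈ canonicalSubalgebra A) :
    x ∈ wordSpan (ckGen A) :=
  (isCKFamily_ckGen A).mem_wordSpan_of_mem_adjoin (mem_adjoin_of_mem_canonicalSubalgebra A hx)

theorem ckPhi_mem_algTensor {x : CKAlg (A ⊗ₖ B)} (hx : x ∈ canonicalSubalgebra (A ⊗ₖ B)) :
    ckPhi A B x ∈ algTensor (canonicalSubalgebra A) (canonicalSubalgebra B) := by
  refine Submodule.span_induction ?_ (by simp) (fun x y _ _ hx hy => ?_) (fun c x _ hx => ?_)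
    (mem_wordSpan_of_mem_canonicalSubalgebra _ hx)
  · rintro _ ⟨⟨μ, ν⟩, rfl⟩
    rw [ckPhi_word_mul_star]
    exact tmul_mem_algTensor (word_mul_star_mem_canonicalSubalgebra A _ _)
      (word_mul_star_mem_canonicalSubalgebra B _ _)
  · rw [map_add]; exact add_mem hx hy
  · rw [map_smul]; exact Submodule.smul_mem _ _ hx

/-- The image under `φ` of the canonical subalgebra. -/
def phiCanonical : Submodule ℂ (MinTensor (CKAlg A) (CKAlg B)) :=
  (canonicalSubalgebra (A ⊗ₖ B)).toSubmodule.map ((ckPhi A B : _ →ₐ[ℂ] _).toLinearMap)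

theorem mem_phiCanonical {z : MinTensor (CKAlg A) (CKAlg B)} :
    z ∈ phiCanonical A B ↔ ∃ y ∈ canonicalSubalgebra (A ⊗ₖ B), ckPhi A B y = z := Iff.rfl

theorem tmul_word_mem_of_length_eq {μ ν : List ι} {μ' ν' : List κ} (hμ : μ.length = μ'.length)
    (hν : ν.length = ν'.length) :
    tmul (word (ckGen A) μ * star (word (ckGen A) ν))
      (word (ckGen B) μ' * star (word (ckGen B) ν')) ∈ phiCanonical A B := by
  refine (mem_phiCanonical A B).2
    ⟨_, word_mul_star_mem_canonicalSubalgebra _ (μ.zip μ') (ν.zip ν'), ?_⟩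
  rw [ckPhi_word_mul_star, List.map_fst_zip hμ.le, List.map_fst_zip hν.le,
    List.map_snd_zip hμ.ge, List.map_snd_zip hν.ge]

variable {A} in
theorem IsCKFamily.word_mul_star_eq_sum {D : Type*} [CStarAlgebra D] {s : ι → D}
    (h : IsCKFamily A s) (μ ν : List ι) :
    word s μ * star (word s ν) = ∑ i, word s (μ ++ [i]) * star (word s (ν ++ [i])) := by
  have h1 (i : ι) : word s (μ ++ [i]) * star (word s (ν ++ [i])) =
      word s μ * (s i * star (s i)) * star (word s ν) := by
    simp [word_append, mul_assoc]
  simp_rw [h1, ← Finset.sum_mul, ← Finset.mul_sum, h.sum_range, mul_one]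

theorem tmul_word_mem_of_length_add_left (k : ℕ) {μ ν : List ι} {μ' ν' : List κ}
    (hμ : μ.length + k = μ'.length) (hν : ν.length + k = ν'.length) :
    tmul (word (ckGen A) μ * star (word (ckGen A) ν))
      (word (ckGen B) μ' * star (word (ckGen B) ν')) ∈ phiCanonical A B := by
  induction k generalizing μ ν with
  | zero => exact tmul_word_mem_of_length_eq A B hμ hν
  | succ k ih =>
    rw [(isCKFamily_ckGen A).word_mul_star_eq_sum, ← tmulₗ_apply, map_sum, LinearMap.sum_apply]
    refine sum_mem fun i _ => ih ?_ ?_ <;> simp <;> omega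

theorem tmul_word_mem_of_length_add_right (k : ℕ) {μ ν : List ι} {μ' ν' : List κ}
    (hμ : μ.length = μ'.length + k) (hν : ν.length = ν'.length + k) :
    tmul (word (ckGen A) μ * star (word (ckGen A) ν))
      (word (ckGen B) μ' * star (word (ckGen B) ν')) ∈ phiCanonical A B := by
  induction k generalizing μ' ν' with
  | zero => exact tmul_word_mem_of_length_eq A B hμ hν
  | succ k ih =>
    rw [(isCKFamily_ckGen B).word_mul_star_eq_sum, ← tmulₗ_apply, map_sum]
    refine sum_mem fun i _ => ih ?_ ?_ <;> simp <;> omega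

/-- If `s_μ s_ν*` and `t_μ' t_ν'*` have the same degree, then the shorter one of them can be
expanded by `∑ sᵢsᵢ* = 1` until `μ` and `μ'` have the same length, and so do `ν` and `ν'`. -/
theorem tmul_word_mem_of_degree_eq {μ ν : List ι} {μ' ν' : List κ}
    (h : (μ.length - ν.length : ℤ) = μ'.length - ν'.length) :
    tmul (word (ckGen A) μ * star (word (ckGen A) ν))
      (word (ckGen B) μ' * star (word (ckGen B) ν')) ∈ phiCanonical A B := by
  rcases le_total μ.length μ'.length with hle | hle
  · obtain ⟨k, hk⟩ := Nat.exists_eq_add_of_le hle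
    exact tmul_word_mem_of_length_add_left A B k (by omega) (by omega)
  · obtain ⟨k, hk⟩ := Nat.exists_eq_add_of_le hle
    exact tmul_word_mem_of_length_add_right A B k (by omega) (by omega)

/-- The action of the circle on `𝒪_A ⊗ 𝒪_B` for which `sᵢ ⊗ 1` has degree `1` and `1 ⊗ sⱼ` has
degree `-1`. -/
def antiGauge (z : Circle) : MinTensor (CKAlg A) (CKAlg B) →⋆ₐ[ℂ] MinTensor (CKAlg A) (CKAlg B) :=
  MinTensor.map (gauge A z) (gauge B z⁻¹)

theorem antiGauge_ckPhi (z : Circle) (x : CKAlg (A ⊗ₖ B)) :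
    antiGauge A B z (ckPhi A B x) = ckPhi A B x := by
  have : (antiGauge A B z).comp (ckPhi A B) = ckPhi A B :=
    starAlgHom_ext_of_ckGen _ fun q => by
      rw [StarAlgHom.comp_apply, ckPhi_ckGen, antiGauge, MinTensor.map_tmul, gauge_ckGen,
        gauge_ckGen, tmul_smul_left, tmul_smul_right, smul_smul, ← Circle.coe_mul,
        mul_inv_cancel, Circle.coe_one, one_smul]
  exact DFunLike.congr_fun this x

theorem antiGauge_tmul_word (z : Circle) (μ ν : List ι) (μ' ν' : List κ) :
    antiGauge A B z (tmul (word (ckGen A) μ * star (word (ckGen A) ν))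
      (word (ckGen B) μ' * star (word (ckGen B) ν'))) =
    (z : ℂ) ^ ((μ.length - ν.length : ℤ) - (μ'.length - ν'.length : ℤ)) •
      tmul (word (ckGen A) μ * star (word (ckGen A) ν))
        (word (ckGen B) μ' * star (word (ckGen B) ν')) := by
  rw [antiGauge, MinTensor.map_tmul, gauge_word_mul_star, gauge_word_mul_star, tmul_smul_left,
    tmul_smul_right, smul_smul, zpow_sub₀ (Circle.coe_ne_zero z) (_ - _),
    Circle.coe_inv, inv_zpow, div_eq_mul_inv]

/-- The elements with a continuous orbit under the action `antiGauge` whose average lies in the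
image of the canonical subalgebra. -/
def antiGaugeAvgIn : Submodule ℂ (MinTensor (CKAlg A) (CKAlg B)) where
  carrier := {z | Continuous (fun t => antiGauge A B (circleParam t) z) ∧
    ∫ t in (0 : ℝ)..1, antiGauge A B (circleParam t) z ∈ phiCanonical A B}
  zero_mem' := by simp [continuous_const, zero_mem]
  add_mem' := fun {x y} hx hy => by
    refine ⟨by simp only [map_add]; exact hx.1.add hy.1, ?_⟩
    simp only [map_add]
    rw [intervalIntegral.integral_add (hx.1.intervalIntegrable _ _) (hy.1.intervalIntegrable _ _)]
    exact add_mem hx.2 hy.2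
  smul_mem' := fun c x hx => by
    refine ⟨by simp only [map_smul]; exact hx.1.const_smul c, ?_⟩
    simp only [map_smul]
    rw [intervalIntegral.integral_smul]
    exact Submodule.smul_mem _ _ hx.2

theorem algTensor_le_antiGaugeAvgIn :
    algTensor (canonicalSubalgebra A) (canonicalSubalgebra B) ≤ antiGaugeAvgIn A B := by
  refine Submodule.span_le.2 ?_
  rintro _ ⟨a, ha, b, hb, rfl⟩
  have h1 := Submodule.apply_mem_map₂ (tmulₗ (CKAlg A) (CKAlg B))
    (mem_wordSpan_of_mem_canonicalSubalgebra A ha) (mem_wordSpan_of_mem_canonicalSubalgebra B hb)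
  rw [wordSpan, wordSpan, Submodule.map₂_span_span] at h1
  refine Submodule.span_le.2 ?_ h1
  rintro _ ⟨_, ⟨⟨μ, ν⟩, rfl⟩, _, ⟨⟨μ', ν'⟩, rfl⟩, rfl⟩
  change tmul (word (ckGen A) μ * star (word (ckGen A) ν))
      (word (ckGen B) μ' * star (word (ckGen B) ν')) ∈ antiGaugeAvgIn A B
  refine ⟨?_, ?_⟩
  · simp_rw [antiGauge_tmul_word]
    refine Continuous.smul (Continuous.zpow₀ (by have := continuous_circleParam; fun_prop) _
      fun t => Or.inl (Circle.coe_ne_zero _)) continuous_const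
  · simp_rw [antiGauge_tmul_word, integral_circleParam_zpow_smul]
    split_ifs with hd
    · exact tmul_word_mem_of_degree_eq A B (by omega)
    · exact zero_mem _

/-- An element of the image of `φ` that lies in the algebraic tensor product of the canonical
subalgebras is the image of an element of the canonical subalgebra: it equals its own average over
the action `antiGauge`. -/
theorem mem_phiCanonical_of_mem_algTensor {x : CKAlg (A ⊗ₖ B)}
    (hx : ckPhi A B x ∈ algTensor (canonicalSubalgebra A) (canonicalSubalgebra B)) :
    ckPhi A B x ∈ phiCanonical A B := by
  have h := (algTensor_le_antiGaugeAvgIn A B hx).2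
  simpa [antiGauge_ckPhi] using h

end Phi

/-! ### Entire functions with values in closed subspaces -/

section Entire

/-- An entire function that maps the real line into a closed subspace maps the whole plane into
it, by the identity theorem in the quotient space. -/
theorem mem_of_differentiable_of_real_mem {E : Type*} [NormedAddCommGroup E] [NormedSpace ℂ E]
    [CompleteSpace E] {S : Submodule ℂ E} (hS : IsClosed (S : Set E)) {F : ℂ → E}
    (hF : Differentiable ℂ F) (h : ∀ t : ℝ, F t ∈ S) (z : ℂ) : F z ∈ S := by
  have := hS
  have hd : Differentiable ℂ fun w => S.mkQL (F w) := S.mkQL.differentiable.comp hF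
  have hfreq : ∃ᶠ w in nhdsWithin (0 : ℂ) {0}ᶜ, S.mkQL (F w) = 0 := by
    have ht : Filter.Tendsto (fun t : ℝ => (t : ℂ)) (nhdsWithin 0 {0}ᶜ)
        (nhdsWithin (0 : ℂ) {0}ᶜ) := by
      refine tendsto_nhdsWithin_of_tendsto_nhds_of_eventually_within _ ?_ ?_
      · exact (Complex.continuous_ofReal.tendsto' 0 0 Complex.ofReal_zero).mono_left
          nhdsWithin_le_nhds
      · filter_upwards [self_mem_nhdsWithin] with t ht
        simpa using ht
    refine ht.frequently (Filter.Eventually.frequently (Filter.Eventually.of_forall fun t => ?_))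
    exact (Submodule.Quotient.mk_eq_zero S).2 (h t)
  have h0 := (Complex.analyticOnNhd_univ_iff_differentiable.2 hd).eq_of_frequently_eq
    (g := fun _ => 0) analyticOnNhd_const hfreq
  exact (Submodule.Quotient.mk_eq_zero S).1 (congrFun h0 z)

/-- A function is differentiable if its composition with a linear isometry of a complete space is:
the difference quotients of the composition, hence also their limits, lie in the closed range. -/
theorem differentiable_of_linearIsometry_comp {E E' : Type*} [NormedAddCommGroup E]
    [NormedSpace ℂ E] [CompleteSpace E] [NormedAddCommGroup E'] [NormedSpace ℂ E']
    (L : E →ₗᵢ[ℂ] E') {f : ℂ → E} (h : Differentiable ℂ fun z => L (f z)) :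
    Differentiable ℂ f := by
  intro z
  have h1 := hasDerivAt_iff_tendsto_slope.1 (h z).hasDerivAt
  have hs : slope (fun z => L (f z)) z = fun w => L (slope f z w) := by
    funext w
    simp [slope_def_module]
  rw [hs] at h1
  obtain ⟨d, hd⟩ : deriv (fun z => L (f z)) z ∈ Set.range L :=
    L.isometry.isClosedEmbedding.isClosed_range.mem_of_tendsto h1
      (Filter.Eventually.of_forall fun w => ⟨_, rfl⟩)
  rw [← hd] at h1
  exact (hasDerivAt_iff_tendsto_slope.2
    (L.isometry.isEmbedding.tendsto_nhds_iff.2 h1)).differentiableAt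

/-- An entire function that maps the real line into the range of an injective ⋆-homomorphism `f`
lifts along `f` to an entire function. -/
theorem exists_entire_lift {X Y : Type*} [CStarAlgebra X] [CStarAlgebra Y] {f : X →⋆ₐ[ℂ] Y}
    (hf : Function.Injective f) {F : ℂ → Y} (hF : Differentiable ℂ F)
    (h : ∀ t : ℝ, ∃ x, f x = F t) : ∃ g : ℂ → X, Differentiable ℂ g ∧ ∀ z, f (g z) = F z := by
  let L : X →ₗᵢ[ℂ] Y := ⟨(f : X →ₐ[ℂ] Y).toLinearMap, NonUnitalStarAlgHom.norm_map f hf⟩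
  have hrange (z : ℂ) : F z ∈ LinearMap.range L.toLinearMap :=
    mem_of_differentiable_of_real_mem (S := LinearMap.range L.toLinearMap)
      L.isometry.isClosedEmbedding.isClosed_range hF h z
  choose g hg using hrange
  replace hg : ∀ z, L (g z) = F z := hg
  exact ⟨g, differentiable_of_linearIsometry_comp L (by simpa only [hg] using hF), hg⟩

end Entire

/-! ### Tensor products of flows -/

section Flow

variable {X Y : Type u} [CStarAlgebra X] [CStarAlgebra Y]

theorem MinTensor.map_map {X' Y' X'' Y'' : Type u} [CStarAlgebra X'] [CStarAlgebra Y']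
    [CStarAlgebra X''] [CStarAlgebra Y''] (f : X' →⋆ₐ[ℂ] X'') (g : Y' →⋆ₐ[ℂ] Y'')
    (f' : X →⋆ₐ[ℂ] X') (g' : Y →⋆ₐ[ℂ] Y') (z : MinTensor X Y) :
    MinTensor.map f g (MinTensor.map f' g' z) = MinTensor.map (f.comp f') (g.comp g') z := rfl

theorem MinTensor.map_id (z : MinTensor X Y) :
    MinTensor.map (StarAlgHom.id ℂ X) (StarAlgHom.id ℂ Y) z = z := rfl

variable (α₁ : CStarFlow X) (α₂ : CStarFlow Y)

theorem flowTensor_tmul (s t : ℝ) (a : X) (b : Y) :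
    flowTensor α₁ α₂ s t (tmul a b) = tmul (α₁ s a) (α₂ t b) := rfl

theorem flowTensor_zero (z : MinTensor X Y) : flowTensor α₁ α₂ 0 0 z = z := by
  have h1 : (α₁ 0 : X →⋆ₐ[ℂ] X) = StarAlgHom.id ℂ X := StarAlgHom.ext α₁.map_zero'
  have h2 : (α₂ 0 : Y →⋆ₐ[ℂ] Y) = StarAlgHom.id ℂ Y := StarAlgHom.ext α₂.map_zero'
  rw [flowTensor, h1, h2, MinTensor.map_id]

theorem flowTensor_add (s s' t t' : ℝ) (z : MinTensor X Y) :
    flowTensor α₁ α₂ (s + s') (t + t') z =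
      flowTensor α₁ α₂ s t (flowTensor α₁ α₂ s' t' z) := by
  have h1 : (α₁ (s + s') : X →⋆ₐ[ℂ] X) = (α₁ s : X →⋆ₐ[ℂ] X).comp (α₁ s' : X →⋆ₐ[ℂ] X) :=
    StarAlgHom.ext (α₁.map_add' s s')
  have h2 : (α₂ (t + t') : Y →⋆ₐ[ℂ] Y) = (α₂ t : Y →⋆ₐ[ℂ] Y).comp (α₂ t' : Y →⋆ₐ[ℂ] Y) :=
    StarAlgHom.ext (α₂.map_add' t t')
  rw [flowTensor, flowTensor, flowTensor, MinTensor.map_map, h1, h2]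

theorem continuous_flowTensor {M : NonUnitalStarSubalgebra ℂ X} {N : NonUnitalStarSubalgebra ℂ Y}
    (β₁ β₂ : ℝ) {z : MinTensor X Y} (hz : z ∈ algTensor M N) :
    Continuous fun t : ℝ => flowTensor α₁ α₂ (β₁ * t) (β₂ * t) z := by
  refine Submodule.span_induction ?_ ?_ (fun x y _ _ hx hy => ?_) (fun c x _ hx => ?_) hz
  · rintro _ ⟨a, -, b, -, rfl⟩
    have h1 : Continuous fun t : ℝ => α₁ (β₁ * t) a := (α₁.continuous' a).comp (by fun_prop)
    have h2 : Continuous fun t : ℝ => α₂ (β₂ * t) b := (α₂.continuous' b).comp (by fun_prop)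
    simp_rw [flowTensor_tmul, ← tmulL_apply]
    exact ((tmulL X Y).continuous.comp h1).clm_apply h2
  · simp_rw [map_zero]; exact continuous_const
  · simp_rw [map_add]; exact hx.add hy
  · simp_rw [map_smul]; exact hx.const_smul c

variable {α₁ α₂}

/-- The KMS conditions for two states give the KMS condition at inverse temperature `1` for the
product state and the tensor product of the rescaled flows, on the algebraic tensor product: if
`f` and `g` continue the orbits of `a` and `b` analytically, then `f(β₁z) ⊗ g(β₂z)` continues the
orbit of `a ⊗ b`, and its value at `z = i` is `f(iβ₁) ⊗ g(iβ₂)`. -/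
theorem exists_entire_of_mem_algTensor {β₁ β₂ : ℝ} {ρ₁ : CState X} {ρ₂ : CState Y}
    {M : NonUnitalStarSubalgebra ℂ X} {N : NonUnitalStarSubalgebra ℂ Y}
    (h₁ : KMSOn α₁ β₁ ρ₁ M) (h₂ : KMSOn α₂ β₂ ρ₂ N) {z : MinTensor X Y}
    (hz : z ∈ algTensor M N) :
    ∃ F : ℂ → MinTensor X Y, Differentiable ℂ F ∧
      (∀ t : ℝ, F t = flowTensor α₁ α₂ (β₁ * t) (β₂ * t) z) ∧
      ∀ w ∈ algTensor M N, ρ₁.tensor ρ₂ (w * F Complex.I) = ρ₁.tensor ρ₂ (z * w) := by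
  refine Submodule.span_induction ?_ ?_ (fun x y _ _ hx hy => ?_) (fun c x _ hx => ?_) hz
  · rintro _ ⟨a, ha, b, hb, rfl⟩
    obtain ⟨f, hf, hfα, hfρ⟩ := h₁.kms a ha
    obtain ⟨g, hg, hgα, hgρ⟩ := h₂.kms b hb
    refine ⟨fun z => tmul (f (z * β₁)) (g (z * β₂)), ?_, fun t => ?_, fun w hw => ?_⟩
    · have h1 : Differentiable ℂ fun z : ℂ => f (z * β₁) := hf.comp (by fun_prop)
      have h2 : Differentiable ℂ fun z : ℂ => g (z * β₂) := hg.comp (by fun_prop)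
      simp_rw [← tmulL_apply]
      exact ((tmulL X Y).differentiable.comp h1).clm_apply h2
    · rw [flowTensor_tmul, ← hfα, ← hgα]
      push_cast
      rw [mul_comm (t : ℂ), mul_comm (t : ℂ)]
    · refine Submodule.span_induction ?_ ?_ (fun x y _ _ hx hy => ?_) (fun c x _ hx => ?_) hw
      · rintro _ ⟨c, hc, d, hd, rfl⟩
        rw [tmul_mul_tmul, tmul_mul_tmul, CState.tensor_tmul, CState.tensor_tmul, hfρ c hc,
          hgρ d hd]
      · rw [zero_mul, mul_zero]
      · rw [add_mul, mul_add, map_add, map_add, hx, hy]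
      · rw [smul_mul_assoc, mul_smul_comm, map_smul, map_smul, hx]
  · refine ⟨fun _ => 0, differentiable_const 0, fun t => (map_zero _).symm, fun w _ => ?_⟩
    rw [mul_zero, zero_mul]
  · obtain ⟨F, hF, hFα, hFρ⟩ := hx
    obtain ⟨G, hG, hGα, hGρ⟩ := hy
    refine ⟨fun z => F z + G z, hF.add hG, fun t => ?_, fun w hw => ?_⟩
    · simp only [hFα, hGα, map_add]
    · rw [mul_add, add_mul, map_add, map_add, hFρ w hw, hGρ w hw]
  · obtain ⟨F, hF, hFα, hFρ⟩ := hx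
    refine ⟨fun z => c • F z, hF.const_smul c, fun t => ?_, fun w hw => ?_⟩
    · simp only [hFα, map_smul]
    · rw [mul_smul_comm, smul_mul_assoc, map_smul, map_smul, hFρ w hw]

/-- A one-parameter group of ⋆-endomorphisms that leaves the range of an injective
⋆-homomorphism `f` invariant, and is continuous on it, restricts to a flow along `f`. -/
theorem exists_flow_of_injective {X Y : Type*} [CStarAlgebra X] [CStarAlgebra Y]
    {f : X →⋆ₐ[ℂ] Y} (hf : Function.Injective f) (Θ : ℝ → Y →⋆ₐ[ℂ] Y) (h0 : ∀ y, Θ 0 y = y)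
    (hadd : ∀ s t y, Θ (s + t) y = Θ s (Θ t y)) (hinv : ∀ t x, ∃ y, Θ t (f x) = f y)
    (hcont : ∀ x, Continuous fun t => Θ t (f x)) :
    ∃ τ : CStarFlow X, ∀ t x, f (τ t x) = Θ t (f x) := by
  choose τ hτ using hinv
  have hneg (s t : ℝ) (hst : s + t = 0) (x : X) : τ s (τ t x) = x :=
    hf (by rw [← hτ, ← hτ, ← hadd, hst, h0])
  let e (t : ℝ) : X ≃⋆ₐ[ℂ] X :=
    { toFun := τ t
      invFun := τ (-t)
      left_inv := hneg _ _ (neg_add_cancel t)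
      right_inv := hneg _ _ (add_neg_cancel t)
      map_mul' := fun x y => hf (by rw [map_mul f, ← hτ, ← hτ, ← hτ, map_mul, map_mul])
      map_add' := fun x y => hf (by rw [map_add f, ← hτ, ← hτ, ← hτ, map_add, map_add])
      map_star' := fun x => hf (by rw [map_star f, ← hτ, ← hτ, map_star, map_star])
      map_smul' := fun c x => hf (by rw [map_smul f, ← hτ, ← hτ, map_smul, map_smul]) }
  refine ⟨⟨e, fun x => hf ?_, fun s t x => hf ?_, fun x => ?_⟩, fun t x => (hτ t x).symm⟩
  · exact (hτ 0 x).symm.trans (h0 _)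
  · exact (hτ (s + t) x).symm.trans (by rw [hadd, hτ t x, hτ s]; rfl)
  · refine (NonUnitalStarAlgHom.isometry f hf).isEmbedding.continuous_iff.2 ?_
    exact (hcont x).congr fun t => hτ t x

end Flow

/-! ### Product KMS states -/

section Main

variable {ι κ : Type} [Fintype ι] [Fintype κ] {A : Matrix ι ι ℕ} {B : Matrix κ κ ℕ}
  {α₁ : CStarFlow (CKAlg A)} {α₂ : CStarFlow (CKAlg B)} {β₁ β₂ : ℝ}
  {B₁ : NonUnitalStarSubalgebra ℂ (CKAlg A)} {B₂ : NonUnitalStarSubalgebra ℂ (CKAlg B)}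
  {C : NonUnitalStarSubalgebra ℂ (CKAlg (A ⊗ₖ B))}

/-- Invariance of the image of a dense subalgebra `C` under `α¹_{β₁t} ⊗ α²_{β₂t}` passes to the
whole range of `φ`, which is closed, and yields a flow on `𝒪_{A ⊠ B}`. -/
theorem exists_flow_of_invariant (hφ : Function.Injective (ckPhi A B))
    (hC : Dense (C : Set (CKAlg (A ⊗ₖ B)))) (hCB : ∀ x ∈ C, ckPhi A B x ∈ algTensor B₁ B₂)
    (hinv : ∀ t : ℝ, ∀ x ∈ C, ∃ y ∈ C,
      flowTensor α₁ α₂ (β₁ * t) (β₂ * t) (ckPhi A B x) = ckPhi A B y) :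
    ∃ τ : CStarFlow (CKAlg (A ⊗ₖ B)), ∀ t x,
      ckPhi A B (τ t x) = flowTensor α₁ α₂ (β₁ * t) (β₂ * t) (ckPhi A B x) := by
  have hiso := NonUnitalStarAlgHom.isometry (ckPhi A B) hφ
  refine exists_flow_of_injective hφ (fun t => flowTensor α₁ α₂ (β₁ * t) (β₂ * t)) (fun y => ?_)
    (fun s t y => ?_) (fun t x => ?_) (fun x => ?_)
  · rw [mul_zero, mul_zero, flowTensor_zero]
  · rw [mul_add, mul_add, flowTensor_add]
  · have hcl : IsClosed {x | flowTensor α₁ α₂ (β₁ * t) (β₂ * t) (ckPhi A B x) ∈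
        Set.range (ckPhi A B)} := hiso.isClosedEmbedding.isClosed_range.preimage
      ((continuous_starAlgHom _).comp (continuous_starAlgHom _))
    obtain ⟨y, hy⟩ := hcl.closure_subset_iff.2 (fun x hx => by
      obtain ⟨y, -, hy⟩ := hinv t x hx
      exact ⟨y, hy.symm⟩) (hC x)
    exact ⟨y, hy.symm⟩
  · have hcl := isClosed_setOf_continuous_orbit
      (f := fun (t : ℝ) x => flowTensor α₁ α₂ (β₁ * t) (β₂ * t) (ckPhi A B x)) fun t =>
        lipschitzWith_starAlgHom ((flowTensor α₁ α₂ (β₁ * t) (β₂ * t)).comp (ckPhi A B))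
    exact hcl.closure_subset_iff.2
      (fun x hx => continuous_flowTensor α₁ α₂ β₁ β₂ (hCB x hx)) (hC x)

/-- The KMS condition for the product state holds on `C`: the continuation in `𝒪_A ⊗ 𝒪_B` of the
orbit of `φ(b)` stays in the closed range of `φ`, so it lifts to `𝒪_{A ⊠ B}`. -/
theorem kmsOn_phiTensor {ρ₁ : CState (CKAlg A)} {ρ₂ : CState (CKAlg B)}
    (hφ : Function.Injective (ckPhi A B)) (h₁ : KMSOn α₁ β₁ ρ₁ B₁) (h₂ : KMSOn α₂ β₂ ρ₂ B₂)
    (hC : Dense (C : Set (CKAlg (A ⊗ₖ B)))) (hCB : ∀ x ∈ C, ckPhi A B x ∈ algTensor B₁ B₂)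
    (hinv : ∀ t : ℝ, ∀ x ∈ C, ∃ y ∈ C,
      flowTensor α₁ α₂ (β₁ * t) (β₂ * t) (ckPhi A B x) = ckPhi A B y)
    {τ : CStarFlow (CKAlg (A ⊗ₖ B))} (hτ : ∀ t x,
      ckPhi A B (τ t x) = flowTensor α₁ α₂ (β₁ * t) (β₂ * t) (ckPhi A B x)) :
    KMSOn τ 1 (phiTensor ρ₁ ρ₂) C where
  dense := hC
  invariant t b hb := by
    obtain ⟨y, hy, hyτ⟩ := hinv t b hb
    rwa [hφ ((hτ t b).trans hyτ)]
  kms b hb := by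
    obtain ⟨F, hF, hFΘ, hFρ⟩ := exists_entire_of_mem_algTensor h₁ h₂ (hCB b hb)
    obtain ⟨f, hf, hfF⟩ := exists_entire_lift hφ hF fun t => ⟨τ t b, (hτ t b).trans (hFΘ t).symm⟩
    refine ⟨f, hf, fun t => hφ ?_, fun a ha => ?_⟩
    · rw [hτ, ← hFΘ, hfF]
    · change ρ₁.tensor ρ₂ (ckPhi A B (a * f _)) = ρ₁.tensor ρ₂ (ckPhi A B (b * a))
      rw [Complex.ofReal_one, mul_one, map_mul (ckPhi A B), map_mul (ckPhi A B), hfF, hFρ _ (hCB a ha)]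

end Main
end KMSProduct

end

theorem mainTheorem8 {ι κ : Type} [Fintype ι] [Fintype κ]
    (A : Matrix ι ι ℕ) (B : Matrix κ κ ℕ)
    (hA : KMSProduct.IsNondegenerate A) (hB : KMSProduct.IsNondegenerate B)
    (α₁ : KMSProduct.CStarFlow (KMSProduct.CKAlg A))
    (α₂ : KMSProduct.CStarFlow (KMSProduct.CKAlg B))
    (ρ₁ : KMSProduct.CState (KMSProduct.CKAlg A))
    (ρ₂ : KMSProduct.CState (KMSProduct.CKAlg B))
    (β₁ β₂ : ℝ) (hβ₁ : β₁ ≠ 0) (hβ₂ : β₂ ≠ 0) :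
    (∀ (B₁ : NonUnitalStarSubalgebra ℂ (KMSProduct.CKAlg A))
        (B₂ : NonUnitalStarSubalgebra ℂ (KMSProduct.CKAlg B)),
      KMSProduct.KMSOn α₁ β₁ ρ₁ B₁ → KMSProduct.KMSOn α₂ β₂ ρ₂ B₂ →
      ∀ C : NonUnitalStarSubalgebra ℂ (KMSProduct.CKAlg (A ⊗ₖ B)),
        Dense (C : Set (KMSProduct.CKAlg (A ⊗ₖ B))) →
        (∀ x ∈ C, KMSProduct.ckPhi A B x ∈ KMSProduct.algTensor B₁ B₂) →
        (∀ t : ℝ, ∀ x ∈ C, ∃ y ∈ C,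
          KMSProduct.flowTensor α₁ α₂ (β₁ * t) (β₂ * t) (KMSProduct.ckPhi A B x) =
            KMSProduct.ckPhi A B y) →
        Function.Injective (KMSProduct.ckPhi A B) ∧
        ∃ τ : KMSProduct.CStarFlow (KMSProduct.CKAlg (A ⊗ₖ B)),
          (∀ (t : ℝ) (x : KMSProduct.CKAlg (A ⊗ₖ B)),
            KMSProduct.ckPhi A B (τ t x) =
              KMSProduct.flowTensor α₁ α₂ (β₁ * t) (β₂ * t) (KMSProduct.ckPhi A B x)) ∧
          KMSProduct.IsKMSState τ 1 (KMSProduct.phiTensor ρ₁ ρ₂)) ∧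
    (KMSProduct.KMSOn α₁ β₁ ρ₁ (KMSProduct.canonicalSubalgebra A) →
      KMSProduct.KMSOn α₂ β₂ ρ₂ (KMSProduct.canonicalSubalgebra B) →
      Dense (KMSProduct.canonicalSubalgebra (A ⊗ₖ B) : Set (KMSProduct.CKAlg (A ⊗ₖ B))) ∧
      (∀ x ∈ KMSProduct.canonicalSubalgebra (A ⊗ₖ B),
        KMSProduct.ckPhi A B x ∈ KMSProduct.algTensor (KMSProduct.canonicalSubalgebra A)
          (KMSProduct.canonicalSubalgebra B)) ∧
      ((∀ (t : ℝ) (x : KMSProduct.CKAlg (A ⊗ₖ B)), ∃ y : KMSProduct.CKAlg (A ⊗ₖ B),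
          KMSProduct.flowTensor α₁ α₂ (β₁ * t) (β₂ * t) (KMSProduct.ckPhi A B x) =
            KMSProduct.ckPhi A B y) →
        ∀ t : ℝ, ∀ x ∈ KMSProduct.canonicalSubalgebra (A ⊗ₖ B),
          ∃ y ∈ KMSProduct.canonicalSubalgebra (A ⊗ₖ B),
            KMSProduct.flowTensor α₁ α₂ (β₁ * t) (β₂ * t) (KMSProduct.ckPhi A B x) =
              KMSProduct.ckPhi A B y)) := by 
  refine ⟨fun B₁ B₂ h₁ h₂ C hC hCB hinv => ?_, fun h₁ h₂ => ⟨?_, ?_, fun hinv t x hx => ?_⟩⟩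
  · have hφ := KMSProduct.injective_ckPhi hA hB
    obtain ⟨τ, hτ⟩ := KMSProduct.exists_flow_of_invariant hφ hC hCB hinv
    exact ⟨hφ, τ, hτ, C, KMSProduct.kmsOn_phiTensor hφ h₁ h₂ hC hCB hinv hτ⟩
  · exact KMSProduct.dense_canonicalSubalgebra _
  · exact fun x hx => KMSProduct.ckPhi_mem_algTensor A B hx
  · obtain ⟨y, hy⟩ := hinv t x
    have h := KMSProduct.map_mem_algTensor
      (f := (α₁ (β₁ * t) : KMSProduct.CKAlg A →⋆ₐ[ℂ] KMSProduct.CKAlg A))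
      (g := (α₂ (β₂ * t) : KMSProduct.CKAlg B →⋆ₐ[ℂ] KMSProduct.CKAlg B)) (h₁.invariant (β₁ * t)) (h₂.invariant (β₂ * t))
      (KMSProduct.ckPhi_mem_algTensor A B hx)
    change KMSProduct.flowTensor α₁ α₂ (β₁ * t) (β₂ * t) (KMSProduct.ckPhi A B x) ∈ _ at h
    rw [hy] at h
    obtain ⟨y', hy', h'⟩ := (KMSProduct.mem_phiCanonical A B).1
      (KMSProduct.mem_phiCanonical_of_mem_algTensor A B h)
    exact ⟨y', hy', hy.trans h'.symm⟩
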